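/- **Setting.** $N\ge 1$ agents act in rounds $t=1,2,\dots$. Agent $i$ has a deterministic local cost $f_{i,t}:\mathbb R^d\to\mathbb R$, which is convex, differentiable and $L$-smooth ($\|\nabla f_{i,t}(x)-\nabla f_{i,t}(y)\|\le L\|x-y\|$). Put $f_t=\sum_{i=1}^N f_{i,t}$, let $x_t^*$ be a minimizer of $f_t$ over $\mathbb R^d$, and let $C_T=\sum_{t=2}^T\|x_t^*-x_{t-1}^*\|$. *Network.* At time $t$, agent $i$ can receive a message from $j$ iff $(i,j)\in\mathcal E_t$. There are $w\in(0,1)$ and an integer $B\ge1$ such that for all $t\ge 1$ the weight matrix $W_t$ is doubly stochastic, $[W_t]_{ij}\ge w$ if $(i,j)\in\mathcal E_t$ or $i=j$ and $[W_t]_{ij}=0$ otherwise, and the directed graph with edge set $\mathcal E_t\cup\dots\cup\mathcal E_{t+B-1}$ is strongly connected. *Algorithm.* From deterministic initial states $x_{i,1}$, $$x_{i,t+1}=\sum_{j=1}^N[W_t]_{ij}x_{j,t}-\eta_t\,\mathrm{clip}_{\lambda_t}\big(\widehat\nabla f_{i,t}(x_{i,t})\big),\qquad \mathrm{clip}_{\lambda}(y)=\min\{1,\lambda/\|y\|\}\,y,$$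 where $\widehat\nabla f_{i,t}$ is a random noisy gradient, $\lambda_t=2B_gt^{\alpha}$, $\eta_t=(at+b)^{-\kappa}$, with $a>0$, $a+b>0$, and $$\kappa=\frac{p+1}{2p},\qquad \alpha=\frac1{2p}.$$ *Noise and boundedness.* Let $\mathcal F_t$ be the $\sigma$-field generated by the noisy gradients $\widehat\nabla f_{j,s}(x_{j,s})$, $j\in[N]$, $s<t$. For some $p\in(1,2]$ and $\sigma>0$, for all $i,t$, almost surely $\mathbb E[\widehat\nabla f_{i,t}(x_{i,t})\mid\mathcal F_t]=\nabla f_{i,t}(x_{i,t})$ and $\mathbb E[\|\widehat\nabla f_{i,t}(x_{i,t})-\nabla f_{i,t}(x_{i,t})\|^p\mid\mathcal F_t]\le\sigma^p$. For some $B_X,B_g>0$, for all $i,t$, almost surely $\|x_{i,t}\|\le B_X$, $\|\nabla f_{i,t}(x_{i,t})\|\le B_g$ and $\|\nabla f_{i,t}(\bar x_t)\|\le B_g$, where $\bar x_t=\frac1N\sum_i x_{i,t}$. The dynamic regret is $\mathbf{REG}_T^d=\sum_{i=1}^N\sum_{t=1}^T\big(f_t(x_{i,t})-f_t(x_t^*)\big)$.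 **Corollary 1.** (1) There is a constant $C>0$, depending only on $N,B,w,p,\sigma,L,B_X,B_g,a,b$ and on a bound $R$ for $\max_i\|x_{i,1}-x_1^*\|$, such that for every $T\ge1$, whenever the assumptions hold in the rounds $1,\dots,T$ (and the network assumption for all $t\ge1$), and for every $\delta\in(0,1)$, with probability at least $1-\delta$, $$\mathbf{REG}_T^d\le C\,T^{\frac{1+p}{2p}}\Big(1+C_T+\log\frac1\delta\Big).$$ (2) Consequently, if the assumptions hold in all rounds $t\ge1$, with the same constants, and $\lim_{T\to\infty}C_T/T^{\frac{p-1}{2p}}=0$, then the regret is sublinear with high probability: for every $\delta\in(0,1)$ there are deterministic bounds $b_T$ with $b_T/T\to0$ such that, for every $T\ge1$, $\mathbf{REG}_T^d\le b_T$ with probability at least $1-\delta$. -/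

import Mathlib

open MeasureTheory Filter Topology

namespace ODCSGD

noncomputable section

/-- The decision space `ℝ^d` with the Euclidean norm. -/
abbrev Vec (d : ℕ) : Type := EuclideanSpace ℝ (Fin d)

/-- The clipping operator `clip_c(y) = min {1, c / ‖y‖} y` (it maps `0` to `0`). -/
def clip {d : ℕ} (c : ℝ) (y : Vec d) : Vec d := min 1 (c / ‖y‖) • y

/-- The data of an online distributed optimization problem with `N` agents in `ℝ^d`, on the sample
space `Ω`. Rounds are numbered `t = 1, 2, …`; the values of the sequences at `t = 0` are not used.
* `f i t` is the local cost function `f_{i,t}`;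
* `ghat i t ω x` is the noisy gradient of `f_{i,t}` at the point `x`;
* `W t` is the weight matrix at time `t`;
* `edge t i j` means that agent `i` can receive a message from agent `j` at time `t`;
* `init i` is the initial state `x_{i,1}`;
* `xstar t` is the comparator `x_t^*`. -/
structure OnlineProblem (N d : ℕ) (Ω : Type*) where
  f : Fin N → ℕ → Vec d → ℝ
  ghat : Fin N → ℕ → Ω → Vec d → Vec d
  W : ℕ → Matrix (Fin N) (Fin N) ℝ
  edge : ℕ → Fin N → Fin N → Prop
  init : Fin N → Vec d
  xstar : ℕ → Vec d

/-- The clipping levels `2 B_g t^α`. -/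
def clipLevel (Bg α : ℝ) (t : ℕ) : ℝ := 2 * Bg * (t : ℝ) ^ α

/-- The step sizes `1 / (a t + b)^κ`. -/
def stepSize (a b κ : ℝ) (t : ℕ) : ℝ := 1 / (a * (t : ℝ) + b) ^ κ

namespace OnlineProblem

variable {N d : ℕ} {Ω : Type*}

/-- The iterates of the online distributed clipped stochastic gradient descent with clipping levels
`lam t` and step sizes `eta t`: `Q.state lam eta t ω i` is `x_{i,t}(ω)`, with `x_{i,1} = init i` and
`x_{i,t+1} = ∑ j, [W_t]_{ij} x_{j,t} - eta_t clip_{lam_t} (ghat_{i,t} (x_{i,t}))` for `t ≥ 1`.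
(The value at `t = 0` is a placeholder.) -/
def state (Q : OnlineProblem N d Ω) (lam eta : ℕ → ℝ) : ℕ → Ω → Fin N → Vec d
  | 0 => fun _ => Q.init
  | 1 => fun _ => Q.init
  | t + 2 => fun ω i =>
      (∑ j, Q.W (t + 1) i j • state Q lam eta (t + 1) ω j)
        - eta (t + 1) • clip (lam (t + 1))
            (Q.ghat i (t + 1) ω (state Q lam eta (t + 1) ω i))

/-- The average state at time `t`. -/
def avgState (Q : OnlineProblem N d Ω) (lam eta : ℕ → ℝ) (t : ℕ) (ω : Ω) : Vec d :=
  (1 / (N : ℝ)) • ∑ i, Q.state lam eta t ω i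

/-- The noisy gradient observed by agent `i` at time `t`, at its current state `x_{i,t}`. -/
def obs (Q : OnlineProblem N d Ω) (lam eta : ℕ → ℝ) (i : Fin N) (t : ℕ) (ω : Ω) : Vec d :=
  Q.ghat i t ω (Q.state lam eta t ω i)

/-- The exact gradient of `f_{i,t}` at the current state `x_{i,t}`. -/
def exactGrad (Q : OnlineProblem N d Ω) (lam eta : ℕ → ℝ) (i : Fin N) (t : ℕ) (ω : Ω) : Vec d :=
  gradient (Q.f i t) (Q.state lam eta t ω i)

/-- The `σ`-field `ℱ_t` generated by the noisy gradients observed by all agents at the times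
`1, …, t - 1`. -/
@[reducible] def past (Q : OnlineProblem N d Ω) (lam eta : ℕ → ℝ) (t : ℕ) : MeasurableSpace Ω :=
  ⨆ s ∈ Finset.Ico 1 t, ⨆ i : Fin N, MeasurableSpace.comap (Q.obs lam eta i s) inferInstance

/-- The global cost `f_t = ∑ i, f_{i,t}`. -/
def cost (Q : OnlineProblem N d Ω) (t : ℕ) (x : Vec d) : ℝ := ∑ i, Q.f i t x

/-- The dynamic regret `∑ i, ∑_{t ≤ T} (f_t(x_{i,t}) - f_t(x_t^*))`. -/
def regret (Q : OnlineProblem N d Ω) (lam eta : ℕ → ℝ) (T : ℕ) (ω : Ω) : ℝ :=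
  ∑ i, ∑ t ∈ Finset.Icc 1 T, (Q.cost t (Q.state lam eta t ω i) - Q.cost t (Q.xstar t))

/-- The path length `C_T = ∑_{t=2}^T ‖x_t^* - x_{t-1}^*‖`. -/
def pathLength (Q : OnlineProblem N d Ω) (T : ℕ) : ℝ :=
  ∑ t ∈ Finset.Icc 2 T, ‖Q.xstar t - Q.xstar (t - 1)‖

/-- The assumptions on the communication network: weights at least `w` on the edges and on the
diagonal and zero elsewhere, doubly stochastic weight matrices, and strong connectivity of the union
of any `B` consecutive graphs. -/
structure Network (Q : OnlineProblem N d Ω) (w : ℝ) (B : ℕ) : Prop where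
  weight_ge : ∀ t ≥ 1, ∀ i j, (Q.edge t i j ∨ j = i) → w ≤ Q.W t i j
  weight_zero : ∀ t ≥ 1, ∀ i j, ¬ (Q.edge t i j ∨ j = i) → Q.W t i j = 0
  row_sum : ∀ t ≥ 1, ∀ i, ∑ j, Q.W t i j = 1
  col_sum : ∀ t ≥ 1, ∀ j, ∑ i, Q.W t i j = 1
  connected : ∀ t ≥ 1, ∀ i j,
    Relation.ReflTransGen (fun i' j' => ∃ l < B, Q.edge (t + l) i' j') i j

/-- The assumptions on the local costs in the convex setting, in the rounds `1, …, T`: convexity and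
`L`-smoothness; `xstar t` is a minimizer of the global cost `f_t`. -/
structure ConvexCosts (Q : OnlineProblem N d Ω) (L : ℝ) (T : ℕ) : Prop where
  convex : ∀ i, ∀ t ∈ Finset.Icc 1 T, ConvexOn ℝ Set.univ (Q.f i t)
  differentiable : ∀ i, ∀ t ∈ Finset.Icc 1 T, Differentiable ℝ (Q.f i t)
  smooth : ∀ i, ∀ t ∈ Finset.Icc 1 T, ∀ x y,
    ‖gradient (Q.f i t) x - gradient (Q.f i t) y‖ ≤ L * ‖x - y‖
  minimizer : ∀ t ∈ Finset.Icc 1 T, ∀ x, Q.cost t (Q.xstar t) ≤ Q.cost t x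

/-- The assumptions on the noisy gradients in the rounds `1, …, T`: given the past, the noisy
gradient at the current state is unbiased and its error has a `p`-th moment at most `σ^p`. -/
structure HeavyTailedNoise [MeasurableSpace Ω] (Q : OnlineProblem N d Ω) (P : Measure Ω)
    (lam eta : ℕ → ℝ) (p σ : ℝ) (T : ℕ) : Prop where
  measurable : ∀ i, ∀ t ∈ Finset.Icc 1 T, Measurable (Q.obs lam eta i t)
  integrable : ∀ i, ∀ t ∈ Finset.Icc 1 T,
    Integrable (fun ω => ‖Q.obs lam eta i t ω - Q.exactGrad lam eta i t ω‖ ^ p) P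
  unbiased : ∀ i, ∀ t ∈ Finset.Icc 1 T,
    P[Q.obs lam eta i t | Q.past lam eta t] =ᵐ[P] Q.exactGrad lam eta i t
  moment : ∀ i, ∀ t ∈ Finset.Icc 1 T,
    ∀ᵐ ω ∂P, (P[fun ω' => ‖Q.obs lam eta i t ω' - Q.exactGrad lam eta i t ω'‖ ^ p
      | Q.past lam eta t]) ω ≤ σ ^ p

/-- Almost sure boundedness of the states and of the local gradients along the trajectory, in the
rounds `1, …, T`. -/
structure Bounded [MeasurableSpace Ω] (Q : OnlineProblem N d Ω) (P : Measure Ω)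
    (lam eta : ℕ → ℝ) (BX Bg : ℝ) (T : ℕ) : Prop where
  state_le : ∀ i, ∀ t ∈ Finset.Icc 1 T, ∀ᵐ ω ∂P, ‖Q.state lam eta t ω i‖ ≤ BX
  grad_state_le : ∀ i, ∀ t ∈ Finset.Icc 1 T, ∀ᵐ ω ∂P, ‖Q.exactGrad lam eta i t ω‖ ≤ Bg
  grad_avg_le : ∀ i, ∀ t ∈ Finset.Icc 1 T,
    ∀ᵐ ω ∂P, ‖gradient (Q.f i t) (Q.avgState lam eta t ω)‖ ≤ Bg

/-- All the assumptions of the convex setting up to the horizon `T`. -/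
structure ConvexSetting [MeasurableSpace Ω] (Q : OnlineProblem N d Ω) (P : Measure Ω)
    (lam eta : ℕ → ℝ) (p σ L BX Bg w : ℝ) (B T : ℕ) : Prop where
  network : Q.Network w B
  costs : Q.ConvexCosts L T
  noise : Q.HeavyTailedNoise P lam eta p σ T
  bounded : Q.Bounded P lam eta BX Bg T

end OnlineProblem

end

end ODCSGD

namespace ODCSGD

/-- The first-order inequality for a differentiable convex function. -/
lemma convexOn_gradient_le {d : ℕ} {f : Vec d → ℝ} (hf : ConvexOn ℝ Set.univ f)
    (hd : Differentiable ℝ f) (x y : Vec d) :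
    f x - f y ≤ inner ℝ (gradient f x) (x - y) := by
  have hc : ConvexOn ℝ Set.univ (f ∘ (AffineMap.lineMap x y : ℝ →ᵃ[ℝ] Vec d)) := by
    simpa using hf.comp_affineMap (AffineMap.lineMap x y : ℝ →ᵃ[ℝ] Vec d)
  have hg : HasGradientAt f (gradient f x) x := (hd x).hasGradientAt
  have hder : HasDerivAt (f ∘ (AffineMap.lineMap x y : ℝ →ᵃ[ℝ] Vec d))
      (inner ℝ (gradient f x) (y - x)) 0 := by
    have h1 : HasDerivAt (AffineMap.lineMap x y : ℝ →ᵃ[ℝ] Vec d) (y - x) (0 : ℝ) :=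
      AffineMap.hasDerivAt_lineMap
    have h2 : HasFDerivAt f (InnerProductSpace.toDual ℝ _ (gradient f x))
        ((AffineMap.lineMap x y : ℝ →ᵃ[ℝ] Vec d) 0) := by
      simpa using hg.hasFDerivAt
    simpa using h2.comp_hasDerivAt (0 : ℝ) h1
  have h := hc.le_slope_of_hasDerivAt (Set.mem_univ 0) (Set.mem_univ 1) one_pos hder
  rw [slope_def_field] at h
  simp only [Function.comp_apply, AffineMap.lineMap_apply_one, AffineMap.lineMap_apply_zero,
    sub_zero, div_one] at h
  have : inner ℝ (gradient f x) (x - y) = - inner ℝ (gradient f x) (y - x) := by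
    rw [← inner_neg_right, neg_sub]
  linarith

section Clip

variable {d : ℕ}

lemma norm_clip_le {c : ℝ} (hc : 0 ≤ c) (y : Vec d) : ‖clip c y‖ ≤ c := by
  rw [clip, norm_smul, Real.norm_of_nonneg (le_min zero_le_one (by positivity))]
  rcases eq_or_lt_of_le (norm_nonneg y) with h | h
  · rw [← h]; simpa using hc
  · calc min 1 (c / ‖y‖) * ‖y‖ ≤ c / ‖y‖ * ‖y‖ := by gcongr; exact min_le_right _ _
      _ = c := div_mul_cancel₀ _ h.ne'

lemma clip_eq_self {c : ℝ} {y : Vec d} (h : ‖y‖ ≤ c) : clip c y = y := by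
  rw [clip]
  rcases eq_or_lt_of_le (norm_nonneg y) with h0 | h0
  · rw [norm_eq_zero.mp h0.symm, smul_zero]
  · rw [min_eq_left ((one_le_div h0).2 h), one_smul]

lemma norm_sub_clip {c : ℝ} (hc : 0 ≤ c) {y : Vec d} (h : c < ‖y‖) :
    ‖y - clip c y‖ = ‖y‖ - c := by
  have h0 : 0 < ‖y‖ := hc.trans_lt h
  have h1 : c / ‖y‖ ≤ 1 := (div_le_one h0).2 h.le
  have : y - clip c y = (1 - c / ‖y‖) • y := by
    rw [clip, min_eq_right h1, sub_smul, one_smul]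
  rw [this, norm_smul, Real.norm_of_nonneg (by linarith)]
  field_simp

lemma measurable_clip (c : ℝ) : Measurable (clip c : Vec d → Vec d) := by
  unfold clip
  fun_prop

/-- The clipping error is controlled by the `p`-th power of the noise. -/
lemma norm_sub_clip_le {c p : ℝ} (hc : 0 < c) (hp : 1 < p) {y g : Vec d} (hg : ‖g‖ ≤ c / 2) :
    ‖y - clip c y‖ ≤ (c / 2) ^ (1 - p) * ‖y - g‖ ^ p := by
  rcases le_or_gt ‖y‖ c with h | h
  · rw [clip_eq_self h, sub_self, norm_zero]; positivity
  · rw [norm_sub_clip hc.le h]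
    have h1 : ‖y‖ ≤ ‖y - g‖ + ‖g‖ := by simpa using norm_add_le (y - g) g
    have hz : c / 2 ≤ ‖y - g‖ := by linarith
    have hz0 : 0 < ‖y - g‖ := by linarith
    calc ‖y‖ - c ≤ ‖y - g‖ := by linarith
      _ = ‖y - g‖ ^ (1 - p) * ‖y - g‖ ^ p := by
        rw [← Real.rpow_add hz0]; simp
      _ ≤ (c / 2) ^ (1 - p) * ‖y - g‖ ^ p := by
        gcongr ?_ * _
        exact Real.rpow_le_rpow_of_nonpos (by linarith) hz (by linarith)

/-- The second moment of the clipped noise is controlled by the `p`-th power of the noise. -/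
lemma norm_sub_clip_sq_le {c p : ℝ} (hc : 0 < c) (hp : 1 < p) (hp2 : p ≤ 2) {y g : Vec d}
    (hg : ‖g‖ ≤ c / 2) :
    ‖g - clip c y‖ ^ 2 ≤ 4 * c ^ (2 - p) * ‖y - g‖ ^ p := by
  have hA : ‖g - clip c y‖ ≤ 2 * c := by
    have := norm_sub_le g (clip c y)
    have := norm_clip_le hc.le y
    linarith
  have hB : ‖g - clip c y‖ ≤ 2 * ‖y - g‖ := by
    rcases le_or_gt ‖y‖ c with h | h
    · rw [clip_eq_self h, norm_sub_rev]; linarith [norm_nonneg (y - g)]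
    · have h2 := norm_sub_clip hc.le h
      have h1 : ‖y‖ ≤ ‖y - g‖ + ‖g‖ := by simpa using norm_add_le (y - g) g
      have h3 : ‖g - clip c y‖ ≤ ‖g - y‖ + ‖y - clip c y‖ := by
        simpa using norm_add_le (g - y) (y - clip c y)
      rw [norm_sub_rev g y] at h3
      linarith
  set n := ‖g - clip c y‖ / 2 with hn
  have hn0 : 0 ≤ n := by positivity
  have h1 : n ≤ c := by linarith
  have h2 : n ≤ ‖y - g‖ := by linarith
  have h3 : n ^ 2 ≤ c ^ (2 - p) * ‖y - g‖ ^ p := by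
    rcases eq_or_lt_of_le hn0 with h | h
    · rw [← h]; simp; positivity
    · calc n ^ 2 = n ^ (2 - p) * n ^ p := by
            rw [← Real.rpow_add h]; simp
        _ ≤ _ := by
            gcongr
  have : ‖g - clip c y‖ = 2 * n := by rw [hn]; ring
  rw [this]; nlinarith

end Clip

lemma exp_le_one_add_add_sq {x : ℝ} (hx : |x| ≤ 1) : Real.exp x ≤ 1 + x + x ^ 2 := by
  have := (abs_le.mp (Real.abs_exp_sub_one_sub_id_le hx)).2
  linarith

lemma sum_inv_sqrt_le (T : ℕ) : ∑ t ∈ Finset.Icc 1 T, 1 / √(t : ℝ) ≤ 2 * √(T : ℝ) := by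
  induction T with
  | zero => simp
  | succ n ih =>
    rw [Finset.sum_Icc_succ_top (by omega)]
    have h1 : 0 < √((n + 1 : ℕ) : ℝ) := Real.sqrt_pos.2 (by positivity)
    have h2 : √(n : ℝ) ≤ √((n + 1 : ℕ) : ℝ) := Real.sqrt_le_sqrt (by push_cast; linarith)
    have h3 := Real.sq_sqrt (show (0 : ℝ) ≤ n by positivity)
    have h4 := Real.sq_sqrt (show (0 : ℝ) ≤ (n + 1 : ℕ) by positivity)
    have h5 : 1 / √((n + 1 : ℕ) : ℝ) ≤ 2 * (√((n + 1 : ℕ) : ℝ) - √(n : ℝ)) := by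
      rw [div_le_iff₀ h1]
      push_cast at *
      nlinarith [sq_nonneg (√((n : ℝ) + 1) - √(n : ℝ))]
    linarith

/-- Summation by parts for gradient descent with step sizes `1 / q t` and moving comparators `z t`;
the bound is linear in the size of the comparators. -/
lemma sum_inner_step_le {E : Type*} [NormedAddCommGroup E] [InnerProductSpace ℝ E]
    (q : ℕ → ℝ) (x z g : ℕ → E) {A : ℝ} (hA : 0 ≤ A) (T : ℕ) (hT : 1 ≤ T)
    (hq : ∀ t, 1 ≤ t → 0 < q t) (hmono : ∀ t, 1 ≤ t → q t ≤ q (t + 1))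
    (hx : ∀ t ∈ Finset.Icc 1 (T + 1), ‖x t‖ ≤ A)
    (hg : ∀ t, 1 ≤ t → g t = q t • (x t - x (t + 1))) :
    ∑ t ∈ Finset.Icc 1 T, inner ℝ (g t) (x t - z t) ≤
      q T * (A ^ 2 / 2 + 2 * A * (‖z 1‖ + ∑ t ∈ Finset.Icc 2 T, ‖z t - z (t - 1)‖))
        + ∑ t ∈ Finset.Icc 1 T, ‖g t‖ ^ 2 / (2 * q t) := by
  have hz : ∀ T, 1 ≤ T → ‖z T‖ ≤ ‖z 1‖ + ∑ t ∈ Finset.Icc 2 T, ‖z t - z (t - 1)‖ := by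
    intro T hT
    induction T, hT using Nat.le_induction with
    | base => simp
    | succ n hn ih =>
      rw [Finset.sum_Icc_succ_top (by omega)]
      have := norm_add_le (z (n + 1) - z n) (z n)
      simp only [sub_add_cancel] at this
      simp only [Nat.add_sub_cancel]
      linarith
  have hterm : ∀ t, 1 ≤ t → inner ℝ (g t) (x t - z t) =
      q t * (‖x t‖ ^ 2 / 2 - ‖x (t + 1)‖ ^ 2 / 2) + q t * inner ℝ (x (t + 1) - x t) (z t)
        + ‖g t‖ ^ 2 / (2 * q t) := by
    intro t ht
    have hqt := hq t ht
    have e1 : ‖g t‖ ^ 2 / (2 * q t) = q t * (‖x t - x (t + 1)‖ ^ 2 / 2) := by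
      rw [hg t ht, norm_smul, Real.norm_of_nonneg hqt.le]
      field_simp
    rw [e1, hg t ht, real_inner_smul_left, norm_sub_sq_real, inner_sub_right, inner_sub_left,
      inner_sub_left, inner_sub_left, real_inner_self_eq_norm_sq, real_inner_comm (x t) (x (t + 1))]
    ring
  have key : ∀ T, 1 ≤ T → (∀ t ∈ Finset.Icc 1 (T + 1), ‖x t‖ ≤ A) →
      ∑ t ∈ Finset.Icc 1 T, inner ℝ (g t) (x t - z t) ≤
      q T * ((A ^ 2 / 2 - ‖x (T + 1)‖ ^ 2 / 2) + (inner ℝ (x (T + 1)) (z T)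
        + A * (‖z 1‖ + ∑ t ∈ Finset.Icc 2 T, ‖z t - z (t - 1)‖)))
        + ∑ t ∈ Finset.Icc 1 T, ‖g t‖ ^ 2 / (2 * q t) := by
    intro T hT
    induction T, hT using Nat.le_induction with
    | base =>
      intro hx
      simp only [Finset.Icc_self, Finset.sum_singleton]
      rw [hterm 1 le_rfl]
      have h1 := hx 1 (by simp)
      have h3 : -(‖x 1‖ * ‖z 1‖) ≤ inner ℝ (x 1) (z 1) :=
        (abs_le.mp (abs_real_inner_le_norm (x 1) (z 1))).1
      have h2 : ‖x 1‖ ^ 2 ≤ A ^ 2 := by gcongr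
      have h4 : ‖x 1‖ * ‖z 1‖ ≤ A * ‖z 1‖ := by gcongr
      have hempty : Finset.Icc 2 1 = (∅ : Finset ℕ) := by decide
      simp only [hempty, Finset.sum_empty, add_zero]
      rw [inner_sub_left]
      have := hq 1 le_rfl
      have h5 : q 1 * (‖x 1‖ ^ 2 / 2 - ‖x (1 + 1)‖ ^ 2 / 2)
          + q 1 * (inner ℝ (x (1 + 1)) (z 1) - inner ℝ (x 1) (z 1)) ≤ q 1 *
          (A ^ 2 / 2 - ‖x (1 + 1)‖ ^ 2 / 2 + (inner ℝ (x (1 + 1)) (z 1) + A * ‖z 1‖)) := by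
        rw [← mul_add]
        gcongr ?_ * ?_
        linarith
      linarith
    | succ n hn ih =>
      intro hx
      rw [Finset.sum_Icc_succ_top (by omega), Finset.sum_Icc_succ_top (by omega),
        Finset.sum_Icc_succ_top (by omega), hterm (n + 1) (by omega)]
      have ih' := ih fun t ht => hx t (by simp only [Finset.mem_Icc] at ht ⊢; omega)
      set S := ‖z 1‖ + ∑ t ∈ Finset.Icc 2 n, ‖z t - z (t - 1)‖ with hS
      set G := ∑ t ∈ Finset.Icc 1 n, ‖g t‖ ^ 2 / (2 * q t)
      have hxn : ‖x (n + 1)‖ ≤ A := hx (n + 1) (by simp)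
      have hbr : 0 ≤ (A ^ 2 / 2 - ‖x (n + 1)‖ ^ 2 / 2) + (inner ℝ (x (n + 1)) (z n) + A * S) := by
        have h2 : ‖x (n + 1)‖ ^ 2 ≤ A ^ 2 := by gcongr
        have h3 := (abs_le.mp (abs_real_inner_le_norm (x (n + 1)) (z n))).1
        have h4 : ‖x (n + 1)‖ * ‖z n‖ ≤ A * S := by gcongr; exact hz n hn
        linarith
      have hstep := mul_le_mul_of_nonneg_right (hmono n hn) hbr
      simp only [Nat.add_sub_cancel]
      have h6 : inner ℝ (x (n + 1)) (z n) - inner ℝ (x (n + 1)) (z (n + 1))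
          ≤ A * ‖z (n + 1) - z n‖ := by
        rw [← inner_sub_right]
        calc inner ℝ (x (n + 1)) (z n - z (n + 1)) ≤ ‖x (n + 1)‖ * ‖z n - z (n + 1)‖ :=
              real_inner_le_norm _ _
          _ ≤ A * ‖z (n + 1) - z n‖ := by rw [norm_sub_rev]; gcongr
      have h7 := mul_le_mul_of_nonneg_left h6 (hq (n + 1) (by omega)).le
      rw [inner_sub_left]
      rw [← add_assoc ‖z 1‖, ← hS]
      nlinarith
  refine (key T hT hx).trans ?_
  have h1 := hz T hT
  have h2 := hx (T + 1) (by simp)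
  have h3 : inner ℝ (x (T + 1)) (z T) ≤
      A * (‖z 1‖ + ∑ t ∈ Finset.Icc 2 T, ‖z t - z (t - 1)‖) :=
    (real_inner_le_norm _ _).trans (by gcongr)
  have := hq T hT
  gcongr ?_ * ?_ + _
  nlinarith [sq_nonneg ‖x (T + 1)‖]

/-- The product `W_{t+k-1} ⋯ W_t` of weight matrices. -/
def transProd {N : ℕ} (W : ℕ → Matrix (Fin N) (Fin N) ℝ) (t : ℕ) : ℕ → Matrix (Fin N) (Fin N) ℝ
  | 0 => 1
  | k + 1 => W (t + k) * transProd W t k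

/-- The deviations of the agents from their average. -/
noncomputable def dev {N : ℕ} {E : Type*} [AddCommGroup E] [Module ℝ E] (x : Fin N → E) :
    Fin N → E :=
  fun i => x i - (1 / (N : ℝ)) • ∑ j, x j

namespace OnlineProblem.Network

variable {N d : ℕ} {Ω : Type*} {Q : OnlineProblem N d Ω} {w : ℝ} {B : ℕ}

lemma weight_nonneg (h : Q.Network w B) (hw : 0 < w) {t : ℕ} (ht : 1 ≤ t) (i j : Fin N) :
    0 ≤ Q.W t i j := by
  by_cases hij : Q.edge t i j ∨ j = i
  · exact hw.le.trans (h.weight_ge t ht i j hij)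
  · exact (h.weight_zero t ht i j hij).ge

lemma transProd_nonneg (h : Q.Network w B) (hw : 0 < w) {t : ℕ} (ht : 1 ≤ t) (k : ℕ)
    (i j : Fin N) : 0 ≤ transProd Q.W t k i j := by
  induction k generalizing i with
  | zero => simp only [transProd, Matrix.one_apply]; split_ifs <;> norm_num
  | succ k ih =>
    rw [transProd, Matrix.mul_apply]
    exact Finset.sum_nonneg fun l _ => mul_nonneg (h.weight_nonneg hw (by omega) _ _) (ih l)

lemma transProd_row_sum (h : Q.Network w B) {t : ℕ} (ht : 1 ≤ t) (k : ℕ) (i : Fin N) :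
    ∑ j, transProd Q.W t k i j = 1 := by
  induction k generalizing i with
  | zero => simp [transProd, Matrix.one_apply]
  | succ k ih =>
    simp only [transProd, Matrix.mul_apply]
    rw [Finset.sum_comm]
    simp only [← Finset.mul_sum, ih, mul_one]
    exact h.row_sum _ (by omega) i

lemma transProd_col_sum (h : Q.Network w B) {t : ℕ} (ht : 1 ≤ t) (k : ℕ) (j : Fin N) :
    ∑ i, transProd Q.W t k i j = 1 := by
  induction k with
  | zero => simp [transProd, Matrix.one_apply]
  | succ k ih =>
    simp only [transProd, Matrix.mul_apply]
    rw [Finset.sum_comm]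
    simp only [← Finset.sum_mul]
    rw [← ih]
    refine Finset.sum_congr rfl fun l _ => ?_
    rw [h.col_sum _ (by omega) l, one_mul]

lemma pow_le_transProd_succ (h : Q.Network w B) (hw : 0 < w) {t : ℕ} (ht : 1 ≤ t) {k : ℕ}
    {i l j : Fin N} (hl : w ^ k ≤ transProd Q.W t k l j) (hil : Q.edge (t + k) i l ∨ l = i) :
    w ^ (k + 1) ≤ transProd Q.W t (k + 1) i j := by
  rw [transProd, Matrix.mul_apply, pow_succ']
  refine le_trans ?_ (Finset.single_le_sum
    (f := fun l => Q.W (t + k) i l * transProd Q.W t k l j)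
    (fun l _ => mul_nonneg (h.weight_nonneg hw (by omega) _ _) (h.transProd_nonneg hw ht _ _ _))
    (Finset.mem_univ l))
  exact mul_le_mul (h.weight_ge _ (by omega) _ _ hil) hl (by positivity)
    (h.weight_nonneg hw (by omega) _ _)

lemma pow_le_transProd_add (h : Q.Network w B) (hw : 0 < w) {t : ℕ} (ht : 1 ≤ t) {k : ℕ}
    {i j : Fin N} (hi : w ^ k ≤ transProd Q.W t k i j) (n : ℕ) :
    w ^ (k + n) ≤ transProd Q.W t (k + n) i j := by
  induction n with
  | zero => exact hi
  | succ n ih => exact h.pow_le_transProd_succ hw ht ih (Or.inr rfl)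

/-- Over `N * B` rounds, the information of each agent reaches every agent. -/
lemma pow_le_transProd (h : Q.Network w B) (hw : 0 < w) {t : ℕ} (ht : 1 ≤ t) (i j : Fin N) :
    w ^ (N * B) ≤ transProd Q.W t (N * B) i j := by
  classical
  set S : ℕ → Finset (Fin N) := fun k => {i | w ^ k ≤ transProd Q.W t k i j} with hS
  have hmono : ∀ k n, S k ⊆ S (k + n) := fun k n i hi => by
    simp only [hS, Finset.mem_filter, Finset.mem_univ, true_and] at hi ⊢
    exact h.pow_le_transProd_add hw ht hi n
  have hj : ∀ k, j ∈ S k := fun k => by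
    have : j ∈ S 0 := by simp [hS, transProd]
    simpa using hmono 0 k this
  have hcard : ∀ m, S (m * B) = Finset.univ ∨ m + 1 ≤ (S (m * B)).card := by
    intro m
    induction m with
    | zero => exact Or.inr (Finset.card_pos.2 ⟨j, hj _⟩)
    | succ m ih =>
      have hsub : S (m * B) ⊆ S ((m + 1) * B) := by
        rw [Nat.succ_mul]; exact hmono _ _
      by_cases hu : S (m * B) = Finset.univ
      · left
        rw [hu] at hsub
        exact Finset.univ_subset_iff.mp hsub
      · right
        have hc := ih.resolve_left hu
        obtain ⟨i, hi⟩ : ∃ i, i ∉ S (m * B) := by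
          by_contra! hcon
          exact hu (Finset.eq_univ_iff_forall.2 hcon)
        obtain ⟨a, b, ha, hb, l, hlB, hedge⟩ : ∃ a b, a ∉ S (m * B) ∧ b ∈ S (m * B) ∧
            ∃ l < B, Q.edge (t + m * B + l) a b := by
          by_contra! hcon
          have : ∀ c, Relation.ReflTransGen
              (fun i' j' => ∃ l < B, Q.edge (t + m * B + l) i' j') i c → c ∉ S (m * B) := by
            intro c hic
            induction hic with
            | refl => exact hi
            | tail _ hbc ihc =>
              intro hmem
              obtain ⟨l, hl, he⟩ := hbc
              exact hcon _ _ ihc hmem l hl he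
          exact this j (h.connected _ (by omega) i j) (hj _)
        have ha' : a ∈ S ((m + 1) * B) := by
          have hb' := hmono _ l hb
          have h1 : a ∈ S (m * B + l + 1) := by
            simp only [hS, Finset.mem_filter, Finset.mem_univ, true_and] at hb' ⊢
            exact h.pow_le_transProd_succ hw ht hb' (Or.inl (by rwa [← add_assoc]))
          have h2 := hmono _ (B - l - 1) h1
          have h3 : m * B + l + 1 + (B - l - 1) = (m + 1) * B := by rw [Nat.succ_mul]; omega
          rwa [h3] at h2
        have : (S (m * B)).card < (S ((m + 1) * B)).card :=
          Finset.card_lt_card ⟨hsub, fun hc' => ha (hc' ha')⟩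
        omega
  have hfull : S (N * B) = Finset.univ := by
    rcases hcard N with h1 | h1
    · exact h1
    · have := Finset.card_le_univ (S (N * B))
      rw [Fintype.card_fin] at this
      omega
  have : i ∈ S (N * B) := by rw [hfull]; exact Finset.mem_univ i
  simpa [hS] using this

/-- The contraction factor is in `[0, 1)`. -/
lemma mul_pow_le_one (h : Q.Network w B) (hw : 0 < w) (hN : 1 ≤ N) : N * w ^ (N * B) ≤ 1 := by
  have hs := h.transProd_row_sum (t := 1) le_rfl (N * B) ⟨0, hN⟩
  calc (N : ℝ) * w ^ (N * B) = ∑ _j : Fin N, w ^ (N * B) := by simp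
    _ ≤ _ := Finset.sum_le_sum fun j _ => h.pow_le_transProd hw le_rfl _ j
    _ = 1 := hs

variable {E : Type*} [NormedAddCommGroup E] [NormedSpace ℝ E]

/-- Perturbed consensus contracts over `N * B` rounds, up to the size of the perturbations. -/
lemma norm_dev_add_le (h : Q.Network w B) (hw : 0 < w) (hN : 1 ≤ N) {x : ℕ → Fin N → E}
    {u : ℕ → ℝ} (hx : ∀ t, 1 ≤ t → ∀ i, ‖x (t + 1) i - ∑ j, Q.W t i j • x t j‖ ≤ u t)
    {t : ℕ} (ht : 1 ≤ t) :
    ‖dev (x (t + N * B))‖ ≤ (1 - N * w ^ (N * B)) * ‖dev (x t)‖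
      + 2 * ∑ s ∈ Finset.range (N * B), u (t + s) := by
  have hN0 : (0 : ℝ) < N := by exact_mod_cast hN
  have hpert : ∀ k i, ‖x (t + k) i - ∑ j, transProd Q.W t k i j • x t j‖
      ≤ ∑ s ∈ Finset.range k, u (t + s) := by
    intro k
    induction k with
    | zero => intro i; simp [transProd, Matrix.one_apply]
    | succ k ih =>
      intro i
      rw [Finset.sum_range_succ, ← add_assoc]
      have e : x (t + k + 1) i - ∑ j, transProd Q.W t (k + 1) i j • x t j =
          ∑ l, Q.W (t + k) i l • (x (t + k) l - ∑ j, transProd Q.W t k l j • x t j)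
          + (x (t + k + 1) i - ∑ j, Q.W (t + k) i j • x (t + k) j) := by
        simp only [transProd, Matrix.mul_apply, Finset.sum_smul, smul_sub, Finset.sum_sub_distrib,
          Finset.smul_sum, smul_smul]
        rw [Finset.sum_comm]
        abel
      rw [e]
      refine (norm_add_le _ _).trans (add_le_add ?_ (hx _ (by omega) i))
      calc _ ≤ ∑ l, ‖Q.W (t + k) i l • (x (t + k) l - ∑ j, transProd Q.W t k l j • x t j)‖ :=
            norm_sum_le _ _
        _ ≤ ∑ l, Q.W (t + k) i l * ∑ s ∈ Finset.range k, u (t + s) := by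
            refine Finset.sum_le_sum fun l _ => ?_
            rw [norm_smul, Real.norm_of_nonneg (h.weight_nonneg hw (by omega) _ _)]
            exact mul_le_mul_of_nonneg_left (ih l) (h.weight_nonneg hw (by omega) _ _)
        _ = _ := by rw [← Finset.sum_mul, h.row_sum _ (by omega) i, one_mul]
  set K := N * B with hK
  set β := w ^ K with hβ
  set U := ∑ s ∈ Finset.range K, u (t + s) with hU
  have hU0 : 0 ≤ U := (norm_nonneg _).trans (hpert K ⟨0, hN⟩)
  have hβ1 : 0 ≤ 1 - N * β := sub_nonneg.2 (h.mul_pow_le_one hw hN)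
  set y : Fin N → E := fun i => ∑ j, transProd Q.W t K i j • x t j with hy
  set xb : E := (1 / (N : ℝ)) • ∑ j, x t j with hxb
  have hyavg : ∑ i, y i = ∑ j, x t j := by
    simp only [hy]
    rw [Finset.sum_comm]
    refine Finset.sum_congr rfl fun j _ => ?_
    rw [← Finset.sum_smul, h.transProd_col_sum ht, one_smul]
  have hsum0 : ∑ j, dev (x t) j = 0 := by
    simp only [dev, Finset.sum_sub_distrib, Finset.sum_const, Finset.card_univ, Fintype.card_fin]
    rw [← Nat.cast_smul_eq_nsmul ℝ, smul_smul, mul_one_div_cancel hN0.ne', one_smul, sub_self]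
  have hcontr : ∀ i, ‖y i - xb‖ ≤ (1 - N * β) * ‖dev (x t)‖ := by
    intro i
    have e : y i - xb = ∑ j, (transProd Q.W t K i j - β) • dev (x t) j := by
      simp only [sub_smul, Finset.sum_sub_distrib, ← Finset.smul_sum, hsum0, smul_zero, sub_zero]
      simp only [dev, smul_sub, Finset.sum_sub_distrib, ← Finset.sum_smul]
      rw [h.transProd_row_sum ht, one_smul]
    rw [e]
    calc _ ≤ ∑ j, ‖(transProd Q.W t K i j - β) • dev (x t) j‖ := norm_sum_le _ _
      _ ≤ ∑ j, (transProd Q.W t K i j - β) * ‖dev (x t)‖ := by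
          refine Finset.sum_le_sum fun j _ => ?_
          have h0 : 0 ≤ transProd Q.W t K i j - β := sub_nonneg.2 (h.pow_le_transProd hw ht i j)
          rw [norm_smul, Real.norm_of_nonneg h0]
          exact mul_le_mul_of_nonneg_left (norm_le_pi_norm _ j) h0
      _ = _ := by
          rw [← Finset.sum_mul, Finset.sum_sub_distrib, h.transProd_row_sum ht]
          simp
  refine (pi_norm_le_iff_of_nonneg (by positivity)).2 fun i => ?_
  have e : dev (x (t + K)) i = (x (t + K) i - y i) + (y i - xb)
      - (1 / (N : ℝ)) • ∑ j, (x (t + K) j - y j) := by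
    simp only [dev, Finset.sum_sub_distrib, hyavg, smul_sub, ← hxb]
    abel
  have hlast : ‖(1 / (N : ℝ)) • ∑ j, (x (t + K) j - y j)‖ ≤ U := by
    rw [norm_smul, Real.norm_of_nonneg (by positivity)]
    calc _ ≤ 1 / (N : ℝ) * ∑ _j : Fin N, U := by
          gcongr
          exact norm_sum_le_of_le _ fun j _ => hpert K j
      _ = U := by simp; field_simp
  rw [e]
  have h1 := norm_sub_le ((x (t + K) i - y i) + (y i - xb))
    ((1 / (N : ℝ)) • ∑ j, (x (t + K) j - y j))
  have h2 := norm_add_le (x (t + K) i - y i) (y i - xb)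
  have h3 := hpert K i
  have h4 := hcontr i
  linarith

end OnlineProblem.Network

lemma sum_Icc_shift_le {u : ℕ → ℝ} (hu : ∀ t, 1 ≤ t → 0 ≤ u t) (n s : ℕ) :
    ∑ t ∈ Finset.Icc 1 n, u (t + s) ≤ ∑ t ∈ Finset.Icc 1 (n + s), u t := by
  induction n with
  | zero =>
    simp only [Finset.Icc_eq_empty_of_lt one_pos, Finset.sum_empty]
    exact Finset.sum_nonneg fun t ht => hu t (Finset.mem_Icc.1 ht).1
  | succ n ih =>
    rw [Finset.sum_Icc_succ_top (by omega), show n + 1 + s = n + s + 1 by omega,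
      Finset.sum_Icc_succ_top (by omega)]
    linarith

/-- Summing a contraction that holds over `K` rounds. -/
lemma sum_le_of_contraction {m u : ℕ → ℝ} {ρ M : ℝ} {K : ℕ} (hρ : 0 ≤ ρ)
    (hu : ∀ t, 1 ≤ t → 0 ≤ u t) (hm : ∀ t, 0 ≤ m t) (T : ℕ) (hM : 0 ≤ M)
    (hmM : ∀ t ∈ Finset.Icc 1 T, m t ≤ M)
    (h : ∀ t, 1 ≤ t → m (t + K) ≤ ρ * m t + 2 * ∑ s ∈ Finset.range K, u (t + s)) :
    (1 - ρ) * ∑ t ∈ Finset.Icc 1 T, m t ≤ K * M + 2 * K * ∑ t ∈ Finset.Icc 1 T, u t := by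
  have hu0 : 0 ≤ ∑ t ∈ Finset.Icc 1 T, u t :=
    Finset.sum_nonneg fun t ht => hu t (Finset.mem_Icc.1 ht).1
  have hm0 : 0 ≤ ∑ t ∈ Finset.Icc 1 T, m t := Finset.sum_nonneg fun t _ => hm t
  have hshort : ∀ n ≤ T, ∑ t ∈ Finset.Icc 1 n, m t ≤ n * M := fun n hn => by
    calc _ ≤ ∑ _t ∈ Finset.Icc 1 n, M := Finset.sum_le_sum fun t ht => hmM t (by
          simp only [Finset.mem_Icc] at ht ⊢; omega)
      _ = n * M := by simp
  rcases le_total T K with hTK | hTK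
  · have h1 := hshort T le_rfl
    have h2 : (T : ℝ) * M ≤ K * M := by gcongr
    have h3 : 0 ≤ 2 * K * ∑ t ∈ Finset.Icc 1 T, u t := by positivity
    nlinarith
  · obtain ⟨n, rfl⟩ := Nat.exists_eq_add_of_le hTK
    have hsplit : ∀ n, ∑ t ∈ Finset.Icc 1 (K + n), m t
        = ∑ t ∈ Finset.Icc 1 K, m t + ∑ t ∈ Finset.Icc 1 n, m (t + K) := by
      intro n
      induction n with
      | zero => simp
      | succ n ih =>
        rw [← add_assoc, Finset.sum_Icc_succ_top (by omega), ih,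
          Finset.sum_Icc_succ_top (by omega), show n + 1 + K = K + n + 1 by omega]
        ring
    have h1 := hshort K hTK
    have h2 : ∑ t ∈ Finset.Icc 1 n, m (t + K) ≤ ρ * ∑ t ∈ Finset.Icc 1 (K + n), m t
        + 2 * K * ∑ t ∈ Finset.Icc 1 (K + n), u t := by
      calc _ ≤ ∑ t ∈ Finset.Icc 1 n, (ρ * m t + 2 * ∑ s ∈ Finset.range K, u (t + s)) :=
            Finset.sum_le_sum fun t ht => h t (Finset.mem_Icc.1 ht).1
        _ = ρ * ∑ t ∈ Finset.Icc 1 n, m t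
            + 2 * ∑ s ∈ Finset.range K, ∑ t ∈ Finset.Icc 1 n, u (t + s) := by
            rw [Finset.sum_add_distrib, ← Finset.mul_sum, ← Finset.mul_sum, Finset.sum_comm]
        _ ≤ ρ * ∑ t ∈ Finset.Icc 1 (K + n), m t
            + 2 * ∑ _s ∈ Finset.range K, ∑ t ∈ Finset.Icc 1 (K + n), u t := by
            gcongr with s hs
            · intro t _ _; exact hm t
            · omega
            · refine (sum_Icc_shift_le hu n s).trans ?_
              refine Finset.sum_le_sum_of_subset_of_nonneg ?_
                fun t ht _ => hu t (Finset.mem_Icc.1 ht).1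
              have := Finset.mem_range.1 hs
              exact Finset.Icc_subset_Icc_right (by omega)
        _ = _ := by simp; ring
    rw [sub_mul, one_mul]
    have := hsplit n
    linarith

section ConditionalExpectation

variable {Ω : Type*} {m m0 : MeasurableSpace Ω} {P : Measure Ω} {E : Type*} [NormedAddCommGroup E]

lemma integrable_inner_of_bdd [InnerProductSpace ℝ E] {h Y : Ω → E}
    (hh : AEStronglyMeasurable h P) {C : ℝ}
    (hC : ∀ᵐ ω ∂P, ‖h ω‖ ≤ C) (hY : Integrable Y P) :
    Integrable (fun ω => inner ℝ (h ω) (Y ω)) P := by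
  refine Integrable.mono' (hY.norm.const_mul C) (hh.inner hY.aestronglyMeasurable) ?_
  filter_upwards [hC] with ω hω
  exact (norm_inner_le_norm _ _).trans (by gcongr)

/-- In an inner product with a past-measurable vector, a random vector may be replaced by its
conditional expectation. -/
lemma integral_inner_condExp [IsProbabilityMeasure P] [InnerProductSpace ℝ E]
    [CompleteSpace E] (hm : m ≤ m0) {h Y G : Ω → E} (hh : StronglyMeasurable[m] h) {C : ℝ}
    (hC : ∀ᵐ ω ∂P, ‖h ω‖ ≤ C) (hY : Integrable Y P) (hG : P[Y | m] =ᵐ[P] G) :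
    ∫ ω, inner ℝ (h ω) (Y ω) ∂P = ∫ ω, inner ℝ (h ω) (G ω) ∂P := by
  have hi := integrable_inner_of_bdd (hh.mono hm).aestronglyMeasurable hC hY
  have := condExp_bilin_of_stronglyMeasurable_left (innerSL ℝ) hh hi hY
  rw [← integral_condExp hm]
  refine integral_congr_ae ?_
  filter_upwards [this, hG] with ω h1 h2
  exact h1.trans (by rw [h2]; rfl)

lemma integral_mul_le_of_condExp_le [IsProbabilityMeasure P] (hm : m ≤ m0) {M ζ : Ω → ℝ}
    (hM : StronglyMeasurable[m] M)
    (hM0 : ∀ ω, 0 ≤ M ω) {C c : ℝ} (hC : ∀ᵐ ω ∂P, M ω ≤ C) (hζ : Integrable ζ P)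
    (hc : ∀ᵐ ω ∂P, (P[ζ | m]) ω ≤ c) :
    ∫ ω, M ω * ζ ω ∂P ≤ c * ∫ ω, M ω ∂P := by
  have hC' : ∀ᵐ ω ∂P, ‖M ω‖ ≤ C := by
    filter_upwards [hC] with ω hω
    rwa [Real.norm_of_nonneg (hM0 ω)]
  have hMm : AEStronglyMeasurable M P := (hM.mono hm).aestronglyMeasurable
  have hMi : Integrable M P := Integrable.of_bound hMm C hC'
  have hi : Integrable (M * ζ) P := hζ.bdd_mul hMm hC'
  have := condExp_mul_of_stronglyMeasurable_left hM hi hζ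
  have e : ∫ ω, M ω * ζ ω ∂P = ∫ ω, (P[M * ζ | m]) ω ∂P := by
    rw [integral_condExp hm]; rfl
  rw [e, ← integral_const_mul]
  refine integral_mono_ae integrable_condExp (hMi.const_mul c) ?_
  filter_upwards [this, hc] with ω h1 h2
  rw [h1, Pi.mul_apply, mul_comm]
  exact mul_le_mul_of_nonneg_right h2 (hM0 ω)

lemma integrable_of_integrable_norm_rpow [IsProbabilityMeasure P] {Z : Ω → E}
    (hZ : AEStronglyMeasurable Z P) {p : ℝ}
    (hp : 1 ≤ p) (h : Integrable (fun ω => ‖Z ω‖ ^ p) P) : Integrable Z P := by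
  refine Integrable.mono' ((integrable_const (1 : ℝ)).add h) hZ (ae_of_all _ fun ω => ?_)
  simp only [Pi.add_apply]
  rcases le_total ‖Z ω‖ 1 with h1 | h1
  · have : 0 ≤ ‖Z ω‖ ^ p := by positivity
    linarith
  · have := Real.rpow_le_rpow_of_exponent_le h1 hp
    rw [Real.rpow_one] at this
    linarith

end ConditionalExpectation

/-- Pointwise bound for the exponential of the clipped noise in the direction `v`. -/
lemma exp_clip_noise_le {N d : ℕ} {c p D θ : ℝ} (hc : 0 < c) (hp : 1 < p) (hp2 : p ≤ 2)
    (hθ : 0 ≤ θ) (hθ1 : θ * (2 * N * c * D) ≤ 1) {v : Vec d} (hv : ‖v‖ ≤ D)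
    {G Y : Fin N → Vec d} (hG : ∀ i, ‖G i‖ ≤ c / 2) :
    Real.exp (θ * ∑ i, inner ℝ (G i - clip c (Y i)) v) ≤
      1 + θ * ∑ i, inner ℝ v (G i - Y i) +
        (θ * D * (c / 2) ^ (1 - p) + 4 * N * θ ^ 2 * D ^ 2 * c ^ (2 - p))
          * ∑ i, ‖Y i - G i‖ ^ p := by
  have hD : 0 ≤ D := (norm_nonneg v).trans hv
  set X := ∑ i, inner ℝ (G i - clip c (Y i)) v with hX
  have hX1 : |X| ≤ 2 * N * c * D := by
    calc |X| ≤ ∑ i, |inner ℝ (G i - clip c (Y i)) v| := Finset.abs_sum_le_sum_abs _ _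
      _ ≤ ∑ _i : Fin N, 2 * c * D := by
          refine Finset.sum_le_sum fun i _ => (abs_real_inner_le_norm _ _).trans ?_
          have h1 := norm_sub_le (G i) (clip c (Y i))
          have h2 := norm_clip_le hc.le (Y i)
          have h3 := hG i
          gcongr
          linarith
      _ = _ := by simp; ring
  have hθX : |θ * X| ≤ 1 := by
    rw [abs_mul, abs_of_nonneg hθ]
    exact (mul_le_mul_of_nonneg_left hX1 hθ).trans hθ1
  have hlin : X ≤ ∑ i, inner ℝ v (G i - Y i) + D * (c / 2) ^ (1 - p) * ∑ i, ‖Y i - G i‖ ^ p := by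
    rw [Finset.mul_sum, ← Finset.sum_add_distrib]
    refine Finset.sum_le_sum fun i _ => ?_
    have e : inner ℝ (G i - clip c (Y i)) v
        = inner ℝ v (G i - Y i) + inner ℝ (Y i - clip c (Y i)) v := by
      rw [real_inner_comm (G i - Y i) v, ← inner_add_left]
      simp
    rw [e]
    have h1 := real_inner_le_norm (Y i - clip c (Y i)) v
    have h2 := norm_sub_clip_le hc hp (y := Y i) (hG i)
    have h3 : ‖Y i - clip c (Y i)‖ * ‖v‖ ≤ (c / 2) ^ (1 - p) * ‖Y i - G i‖ ^ p * D := by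
      gcongr
    linarith
  have hquad : X ^ 2 ≤ 4 * N * D ^ 2 * c ^ (2 - p) * ∑ i, ‖Y i - G i‖ ^ p := by
    calc X ^ 2 ≤ N * ∑ i, (inner ℝ (G i - clip c (Y i)) v) ^ 2 := by
          simpa using sq_sum_le_card_mul_sum_sq (s := (Finset.univ : Finset (Fin N)))
            (f := fun i => (inner ℝ (G i - clip c (Y i)) v : ℝ))
      _ ≤ N * ∑ i, 4 * D ^ 2 * c ^ (2 - p) * ‖Y i - G i‖ ^ p := by
          gcongr with i
          have h1 := abs_real_inner_le_norm (G i - clip c (Y i)) v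
          have h2 := norm_sub_clip_sq_le hc hp hp2 (y := Y i) (hG i)
          calc (inner ℝ (G i - clip c (Y i)) v) ^ 2
              ≤ (‖G i - clip c (Y i)‖ * ‖v‖) ^ 2 := sq_le_sq' (by
                have := (abs_le.mp h1).1; linarith) (abs_le.mp h1).2
            _ = ‖G i - clip c (Y i)‖ ^ 2 * ‖v‖ ^ 2 := by ring
            _ ≤ 4 * c ^ (2 - p) * ‖Y i - G i‖ ^ p * D ^ 2 := by gcongr
            _ = _ := by ring
      _ = _ := by rw [← Finset.mul_sum]; ring
  have h1 := exp_le_one_add_add_sq hθX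
  have h2 := mul_le_mul_of_nonneg_left hlin hθ
  have h3 := mul_le_mul_of_nonneg_left hquad (sq_nonneg θ)
  have e1 : (θ * X) ^ 2 = θ ^ 2 * X ^ 2 := by ring
  rw [e1] at h1
  linarith

/-- One step of the exponential supermartingale argument. -/
lemma integral_mul_exp_clip_noise_le {N d : ℕ} {Ω : Type*} {m m0 : MeasurableSpace Ω}
    {P : Measure Ω} [IsProbabilityMeasure P] (hm : m ≤ m0)
    {c p D θ σ CM : ℝ} (hc : 0 < c) (hp : 1 < p) (hp2 : p ≤ 2) (hD : 0 ≤ D)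
    (hθ : 0 ≤ θ) (hθ1 : θ * (2 * N * c * D) ≤ 1) {v : Ω → Vec d} {M : Ω → ℝ}
    {G Y : Fin N → Ω → Vec d} (hvm : StronglyMeasurable[m] v) (hv : ∀ᵐ ω ∂P, ‖v ω‖ ≤ D)
    (hMm : StronglyMeasurable[m] M) (hM0 : ∀ ω, 0 ≤ M ω) (hM : ∀ᵐ ω ∂P, M ω ≤ CM)
    (hGm : ∀ i, StronglyMeasurable[m] (G i)) (hG : ∀ i, ∀ᵐ ω ∂P, ‖G i ω‖ ≤ c / 2)
    (hYm : ∀ i, Measurable (Y i)) (hZ : ∀ i, Integrable (fun ω => ‖Y i ω - G i ω‖ ^ p) P)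
    (hYG : ∀ i, P[Y i | m] =ᵐ[P] G i)
    (hmom : ∀ i, ∀ᵐ ω ∂P, (P[fun ω' => ‖Y i ω' - G i ω'‖ ^ p | m]) ω ≤ σ ^ p) :
    ∫ ω, M ω * Real.exp (θ * ∑ i, inner ℝ (G i ω - clip c (Y i ω)) (v ω)) ∂P ≤
      (1 + (θ * D * (c / 2) ^ (1 - p) + 4 * N * θ ^ 2 * D ^ 2 * c ^ (2 - p)) * (N * σ ^ p))
        * ∫ ω, M ω ∂P := by
  set k := θ * D * (c / 2) ^ (1 - p) + 4 * N * θ ^ 2 * D ^ 2 * c ^ (2 - p) with hk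
  have hk0 : 0 ≤ k := by positivity
  have hG' := fun i => ((hGm i).mono hm).aestronglyMeasurable (μ := P)
  have hMm' := (hMm.mono hm).aestronglyMeasurable (μ := P)
  have hC' : ∀ᵐ ω ∂P, ‖M ω‖ ≤ CM := by
    filter_upwards [hM] with ω hω
    rwa [Real.norm_of_nonneg (hM0 ω)]
  have hMi : Integrable M P := Integrable.of_bound hMm' CM hC'
  have hGi : ∀ i, Integrable (G i) P := fun i => Integrable.of_bound (hG' i) (c / 2) (hG i)
  have hYi : ∀ i, Integrable (Y i) P := fun i => by
    have h1 := integrable_of_integrable_norm_rpow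
      ((hYm i).aestronglyMeasurable.sub (hG' i)) hp.le (hZ i)
    have h2 := h1.add (hGi i)
    simpa using h2
  have hhm : StronglyMeasurable[m] (fun ω => M ω • v ω) := hMm.smul hvm
  have hhb : ∀ᵐ ω ∂P, ‖M ω • v ω‖ ≤ CM * D := by
    filter_upwards [hC', hv] with ω h1 h2
    rw [norm_smul]
    exact mul_le_mul h1 h2 (norm_nonneg _) ((norm_nonneg _).trans h1)
  have hIi : ∀ i, Integrable (fun ω => inner ℝ (M ω • v ω) (G i ω - Y i ω)) P := fun i =>
    integrable_inner_of_bdd (hhm.mono hm).aestronglyMeasurable hhb ((hGi i).sub (hYi i))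
  have hI0 : ∀ i, ∫ ω, inner ℝ (M ω • v ω) (G i ω - Y i ω) ∂P = 0 := fun i => by
    simp only [inner_sub_right]
    rw [integral_sub, integral_inner_condExp hm hhm hhb (hYi i) (hYG i), sub_self]
    · exact integrable_inner_of_bdd (hhm.mono hm).aestronglyMeasurable hhb (hGi i)
    · exact integrable_inner_of_bdd (hhm.mono hm).aestronglyMeasurable hhb (hYi i)
  have hZi : ∀ i, Integrable (fun ω => M ω * ‖Y i ω - G i ω‖ ^ p) P := fun i =>
    (hZ i).bdd_mul hMm' hC'
  have hZ1 : ∀ i, ∫ ω, M ω * ‖Y i ω - G i ω‖ ^ p ∂P ≤ σ ^ p * ∫ ω, M ω ∂P := fun i =>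
    integral_mul_le_of_condExp_le hm hMm hM0 hM (hZ i) (hmom i)
  have hR1 : Integrable (fun ω => θ * ∑ i, inner ℝ (M ω • v ω) (G i ω - Y i ω)) P :=
    (integrable_finsetSum _ fun i _ => hIi i).const_mul θ
  have hR2 : Integrable (fun ω => k * ∑ i, M ω * ‖Y i ω - G i ω‖ ^ p) P :=
    (integrable_finsetSum _ fun i _ => hZi i).const_mul k
  calc _ ≤ ∫ ω, (M ω + θ * ∑ i, inner ℝ (M ω • v ω) (G i ω - Y i ω)
          + k * ∑ i, M ω * ‖Y i ω - G i ω‖ ^ p) ∂P := by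
        refine integral_mono_of_nonneg (ae_of_all _ fun ω =>
          mul_nonneg (hM0 ω) (Real.exp_nonneg _)) ((hMi.add hR1).add hR2) ?_
        filter_upwards [hv, ae_all_iff.2 hG] with ω h1 h2
        have h3 := mul_le_mul_of_nonneg_left
          (exp_clip_noise_le hc hp hp2 hθ hθ1 h1 (G := fun i => G i ω) (Y := fun i => Y i ω) h2)
          (hM0 ω)
        refine h3.trans_eq ?_
        simp only [real_inner_smul_left, ← Finset.mul_sum]
        ring
    _ = ∫ ω, M ω ∂P + k * ∑ i, ∫ ω, M ω * ‖Y i ω - G i ω‖ ^ p ∂P := by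
        have e1 := integral_add (hMi.add hR1) hR2
        have e2 := integral_add hMi hR1
        simp only [Pi.add_apply] at e1
        rw [e1, e2, integral_const_mul,
          integral_const_mul, integral_finsetSum _ fun i _ => hIi i,
          integral_finsetSum _ fun i _ => hZi i]
        simp [hI0]
    _ ≤ ∫ ω, M ω ∂P + k * ∑ _i : Fin N, σ ^ p * ∫ ω, M ω ∂P := by
        gcongr with i
        exact hZ1 i
    _ = _ := by simp; ring

lemma measurable_sum_smul {Ω ι : Type*} [Fintype ι] {d : ℕ} {m : MeasurableSpace Ω} (c : ι → ℝ)
    {x : ι → Ω → Vec d} (hx : ∀ j, Measurable (x j)) : Measurable (fun ω => ∑ j, c j • x j ω) := by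
  fun_prop

lemma measurable_sub_smul {Ω : Type*} {d : ℕ} {m : MeasurableSpace Ω} (c : ℝ)
    {x y : Ω → Vec d} (hx : Measurable x) (hy : Measurable y) :
    Measurable (fun ω => x ω - c • y ω) := by
  fun_prop

namespace OnlineProblem

variable {N d : ℕ} {Ω : Type*} (Q : OnlineProblem N d Ω) (lam eta : ℕ → ℝ)

lemma past_mono {s t : ℕ} (h : s ≤ t) : Q.past lam eta s ≤ Q.past lam eta t :=
  biSup_mono fun r hr => by simp only [Finset.mem_Ico] at hr ⊢; omega

lemma measurable_obs_past (i : Fin N) {s t : ℕ} (hs : 1 ≤ s) (hst : s < t) :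
    Measurable[Q.past lam eta t] (Q.obs lam eta i s) := by
  have h1 : MeasurableSpace.comap (Q.obs lam eta i s) inferInstance ≤ Q.past lam eta t :=
    le_trans (le_iSup (fun i : Fin N => MeasurableSpace.comap (Q.obs lam eta i s) inferInstance) i)
      (le_iSup₂_of_le s (Finset.mem_Ico.2 ⟨hs, hst⟩) le_rfl)
  exact (comap_measurable (Q.obs lam eta i s)).mono h1 le_rfl

lemma state_succ {t : ℕ} (ht : 1 ≤ t) (ω : Ω) (i : Fin N) :
    Q.state lam eta (t + 1) ω i = (∑ j, Q.W t i j • Q.state lam eta t ω j)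
      - eta t • clip (lam t) (Q.obs lam eta i t ω) := by
  obtain ⟨s, rfl⟩ := Nat.exists_eq_add_of_le' ht
  rfl

lemma measurable_state_past {t : ℕ} (ht : 1 ≤ t) (i : Fin N) :
    Measurable[Q.past lam eta t] (fun ω => Q.state lam eta t ω i) := by
  induction t, ht using Nat.le_induction generalizing i with
  | base => exact @measurable_const _ _ _ (Q.past lam eta 1) _
  | succ t ht ih =>
    simp only [Q.state_succ lam eta ht]
    have h1 : ∀ j, Measurable[Q.past lam eta (t + 1)] (fun ω => Q.state lam eta t ω j) :=
      fun j => (ih j).mono (Q.past_mono lam eta (Nat.le_succ t)) le_rfl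
    have h2 := Q.measurable_obs_past lam eta i ht (Nat.lt_succ_self t)
    have h3 := (measurable_clip (d := d) (lam t)).comp h2
    exact measurable_sub_smul _ (measurable_sum_smul _ h1) h3

lemma measurable_avgState_past {t : ℕ} (ht : 1 ≤ t) :
    Measurable[Q.past lam eta t] (Q.avgState lam eta t) := by
  have h := fun i => Q.measurable_state_past lam eta ht i
  have h1 := measurable_sum_smul (fun _ => 1 / (N : ℝ)) h
  simp only [← Finset.smul_sum] at h1
  exact h1

lemma measurable_exactGrad_past {L : ℝ} {T t : ℕ} (hL : 0 ≤ L) (hQ : Q.ConvexCosts L T)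
    (ht : t ∈ Finset.Icc 1 T) (i : Fin N) :
    Measurable[Q.past lam eta t] (Q.exactGrad lam eta i t) := by
  have hlip : LipschitzWith L.toNNReal (gradient (Q.f i t)) := by
    refine LipschitzWith.of_dist_le_mul fun x y => ?_
    rw [dist_eq_norm, dist_eq_norm, Real.coe_toNNReal _ hL]
    exact hQ.smooth i t ht x y
  exact hlip.continuous.measurable.comp
    (Q.measurable_state_past lam eta (Finset.mem_Icc.1 ht).1 i)

/-- The accumulated clipped noise in the direction of the comparators. -/
noncomputable def noiseSum (T : ℕ) (ω : Ω) : ℝ :=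
  ∑ t ∈ Finset.Icc 1 T, ∑ i,
    inner ℝ (Q.exactGrad lam eta i t ω - clip (lam t) (Q.obs lam eta i t ω))
      (Q.avgState lam eta t ω - Q.xstar t)

variable {Q lam eta}

lemma HeavyTailedNoise.past_le [m0 : MeasurableSpace Ω] {P : Measure Ω} {p σ : ℝ} {T : ℕ}
    (h : Q.HeavyTailedNoise P lam eta p σ T) {t : ℕ} (ht : t ≤ T + 1) :
    Q.past lam eta t ≤ m0 :=
  iSup₂_le fun s hs => iSup_le fun i => (h.measurable i s (by
    simp only [Finset.mem_Ico, Finset.mem_Icc] at hs ⊢; omega)).comap_le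

/-- Exponential moment of the accumulated noise. -/
lemma integral_exp_noiseSum_le [MeasurableSpace Ω] {P : Measure Ω} [IsProbabilityMeasure P]
    {L p σ D θ : ℝ} {T : ℕ} (hL : 0 ≤ L) (hp : 1 < p) (hp2 : p ≤ 2) (hD : 0 ≤ D) (hθ : 0 ≤ θ)
    (hcosts : Q.ConvexCosts L T) (hnoise : Q.HeavyTailedNoise P lam eta p σ T)
    (hσ : 0 ≤ σ)
    (hlam : ∀ t ∈ Finset.Icc 1 T, 0 < lam t)
    (hθ1 : ∀ t ∈ Finset.Icc 1 T, θ * (2 * N * lam t * D) ≤ 1)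
    (hG : ∀ i, ∀ t ∈ Finset.Icc 1 T, ∀ᵐ ω ∂P, ‖Q.exactGrad lam eta i t ω‖ ≤ lam t / 2)
    (hv : ∀ t ∈ Finset.Icc 1 T, ∀ᵐ ω ∂P, ‖Q.avgState lam eta t ω - Q.xstar t‖ ≤ D) :
    (∃ C : ℝ, ∀ᵐ ω ∂P, Real.exp (θ * Q.noiseSum lam eta T ω) ≤ C) ∧
    Measurable (Q.noiseSum lam eta T) ∧
    ∫ ω, Real.exp (θ * Q.noiseSum lam eta T ω) ∂P ≤
      Real.exp (∑ t ∈ Finset.Icc 1 T, (θ * D * (lam t / 2) ^ (1 - p)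
        + 4 * N * θ ^ 2 * D ^ 2 * lam t ^ (2 - p)) * (N * σ ^ p)) := by
  suffices key : ∀ n ≤ T, (∃ C : ℝ, ∀ᵐ ω ∂P, Real.exp (θ * Q.noiseSum lam eta n ω) ≤ C) ∧
      Measurable[Q.past lam eta (n + 1)] (Q.noiseSum lam eta n) ∧
      ∫ ω, Real.exp (θ * Q.noiseSum lam eta n ω) ∂P ≤
        Real.exp (∑ t ∈ Finset.Icc 1 n, (θ * D * (lam t / 2) ^ (1 - p)
          + 4 * N * θ ^ 2 * D ^ 2 * lam t ^ (2 - p)) * (N * σ ^ p)) by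
    obtain ⟨h1, h2, h3⟩ := key T le_rfl
    exact ⟨h1, h2.mono (hnoise.past_le le_rfl) le_rfl, h3⟩
  intro n
  induction n with
  | zero =>
    intro _
    refine ⟨⟨1, by simp [noiseSum]⟩, ?_, by simp [noiseSum]⟩
    have : Q.noiseSum lam eta 0 = fun _ => 0 := by funext ω; simp [noiseSum]
    rw [this]
    exact @measurable_const _ _ _ (Q.past lam eta (0 + 1)) _
  | succ n ih =>
    intro hn
    obtain ⟨⟨C, hC⟩, hmeas, hint⟩ := ih (by omega)
    have ht : n + 1 ∈ Finset.Icc 1 T := Finset.mem_Icc.2 ⟨by omega, hn⟩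
    have hsucc : ∀ ω, Q.noiseSum lam eta (n + 1) ω = Q.noiseSum lam eta n ω + ∑ i,
        inner ℝ (Q.exactGrad lam eta i (n + 1) ω - clip (lam (n + 1)) (Q.obs lam eta i (n + 1) ω))
          (Q.avgState lam eta (n + 1) ω - Q.xstar (n + 1)) := fun ω => by
      rw [noiseSum, Finset.sum_Icc_succ_top (by omega)]; rfl
    have hlam' := hlam _ ht
    have hGt := fun i => hG i _ ht
    refine ⟨⟨C * Real.exp 1, ?_⟩, ?_, ?_⟩
    · filter_upwards [hC, hv _ ht, ae_all_iff.2 hGt] with ω h1 h2 h3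
      rw [hsucc, mul_add, Real.exp_add]
      refine mul_le_mul h1 (Real.exp_le_exp.2 ?_) (Real.exp_nonneg _)
        ((Real.exp_nonneg _).trans h1)
      refine le_trans (mul_le_mul_of_nonneg_left ?_ hθ) (hθ1 _ ht)
      calc _ ≤ ∑ _i : Fin N, 2 * lam (n + 1) * D := by
            refine Finset.sum_le_sum fun i _ => (real_inner_le_norm _ _).trans ?_
            have h1 := norm_sub_le (Q.exactGrad lam eta i (n + 1) ω)
              (clip (lam (n + 1)) (Q.obs lam eta i (n + 1) ω))
            have h2 := norm_clip_le hlam'.le (Q.obs lam eta i (n + 1) ω)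
            have h3 := h3 i
            gcongr
            linarith
        _ = _ := by simp; ring
    · have e : Q.noiseSum lam eta (n + 1) = fun ω => Q.noiseSum lam eta n ω + ∑ i,
          inner ℝ (Q.exactGrad lam eta i (n + 1) ω
            - clip (lam (n + 1)) (Q.obs lam eta i (n + 1) ω))
            (Q.avgState lam eta (n + 1) ω - Q.xstar (n + 1)) := funext hsucc
      rw [e]
      have hm := Q.past_mono lam eta (Nat.le_succ (n + 1))
      have h1 := hmeas.mono hm le_rfl
      have h2 := fun i => (Q.measurable_exactGrad_past lam eta hL hcosts ht i).mono hm le_rfl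
      have h3 := (Q.measurable_avgState_past lam eta (t := n + 1) (by omega)).mono hm le_rfl
      have h4 := fun i => (measurable_clip (d := d) (lam (n + 1))).comp
        (Q.measurable_obs_past lam eta i (s := n + 1) (by omega) (Nat.lt_succ_self (n + 1)))
      let _ := Q.past lam eta (n + 1 + 1)
      exact h1.add (Finset.measurable_fun_sum _ fun i _ =>
        ((h2 i).sub (h4 i)).inner (h3.sub measurable_const))
    · have hM : Measurable[Q.past lam eta (n + 1)]
          (fun ω => Real.exp (θ * Q.noiseSum lam eta n ω)) :=
        Real.measurable_exp.comp (by
          let _ := Q.past lam eta (n + 1)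
          exact hmeas.const_mul θ)
      have hvm : Measurable[Q.past lam eta (n + 1)]
          (fun ω => Q.avgState lam eta (n + 1) ω - Q.xstar (n + 1)) := by
        have h3 := Q.measurable_avgState_past lam eta (t := n + 1) (by omega)
        let _ := Q.past lam eta (n + 1)
        exact h3.sub measurable_const
      have hGm := fun i =>
        (Q.measurable_exactGrad_past lam eta hL hcosts ht i).stronglyMeasurable
      have hstep := integral_mul_exp_clip_noise_le (P := P)
        (M := fun ω => Real.exp (θ * Q.noiseSum lam eta n ω)) (hnoise.past_le (by omega))
        hlam' hp hp2 hD hθ (hθ1 _ ht) (σ := σ) hvm.stronglyMeasurable (hv _ ht)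
        hM.stronglyMeasurable (fun _ => Real.exp_nonneg _) hC hGm hGt
        (fun i => hnoise.measurable i _ ht) (fun i => hnoise.integrable i _ ht)
        (fun i => hnoise.unbiased i _ ht) (fun i => hnoise.moment i _ ht)
      simp only [hsucc, mul_add, Real.exp_add]
      refine hstep.trans ?_
      rw [Finset.sum_Icc_succ_top (by omega), Real.exp_add, mul_comm]
      refine mul_le_mul hint ?_ (by positivity) (Real.exp_nonneg _)
      rw [add_comm]
      exact Real.add_one_le_exp _

/-- High-probability bound for the accumulated noise. -/
lemma measure_noiseSum_gt_le [MeasurableSpace Ω] {P : Measure Ω} [IsProbabilityMeasure P]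
    {θ A δ : ℝ} {T : ℕ} (hθ : 0 < θ) (hδ : 0 < δ)
    (hb : ∃ C : ℝ, ∀ᵐ ω ∂P, Real.exp (θ * Q.noiseSum lam eta T ω) ≤ C)
    (hm : Measurable (Q.noiseSum lam eta T))
    (hA : ∫ ω, Real.exp (θ * Q.noiseSum lam eta T ω) ∂P ≤ Real.exp A) :
    P {ω | (A + Real.log (1 / δ)) / θ ≤ Q.noiseSum lam eta T ω} ≤ ENNReal.ofReal δ := by
  obtain ⟨C, hC⟩ := hb
  have hint : Integrable (fun ω => Real.exp (θ * Q.noiseSum lam eta T ω)) P := by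
    refine Integrable.of_bound
      (Real.measurable_exp.comp (hm.const_mul θ)).aestronglyMeasurable C ?_
    filter_upwards [hC] with ω h
    rwa [Real.norm_of_nonneg (Real.exp_nonneg _)]
  have h1 := mul_meas_ge_le_integral_of_nonneg (ae_of_all _ fun ω => Real.exp_nonneg _) hint
    (Real.exp A / δ)
  have h2 : P.real {ω | Real.exp A / δ ≤ Real.exp (θ * Q.noiseSum lam eta T ω)} ≤ δ := by
    have h3 := h1.trans hA
    have h4 := Real.exp_pos A
    rw [div_mul_eq_mul_div, div_le_iff₀ hδ] at h3
    nlinarith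
  refine le_trans (measure_mono fun ω hω => ?_)
    (by rw [← ENNReal.ofReal_toReal (measure_ne_top P _)]; exact ENNReal.ofReal_le_ofReal h2)
  simp only [Set.mem_ofPred_eq] at hω ⊢
  rw [div_le_iff₀ hθ] at hω
  have h5 : Real.exp A / δ = Real.exp (A + Real.log (1 / δ)) := by
    rw [Real.exp_add, Real.exp_log (by positivity)]; ring
  rw [h5]
  exact Real.exp_le_exp.2 (by linarith)

/-- The boundedness assumption, along one trajectory. -/
structure BoundedAt (Q : OnlineProblem N d Ω) (lam eta : ℕ → ℝ) (BX Bg : ℝ) (T : ℕ) (ω : Ω) :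
    Prop where
  state_le : ∀ t ∈ Finset.Icc 1 T, ∀ i, ‖Q.state lam eta t ω i‖ ≤ BX
  grad_state_le : ∀ t ∈ Finset.Icc 1 T, ∀ i, ‖Q.exactGrad lam eta i t ω‖ ≤ Bg
  grad_avg_le : ∀ t ∈ Finset.Icc 1 T, ∀ i, ‖gradient (Q.f i t) (Q.avgState lam eta t ω)‖ ≤ Bg

lemma Bounded.ae_boundedAt [MeasurableSpace Ω] {P : Measure Ω} {BX Bg : ℝ} {T : ℕ}
    (h : Q.Bounded P lam eta BX Bg T) : ∀ᵐ ω ∂P, Q.BoundedAt lam eta BX Bg T ω := by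
  have key : ∀ {p : Fin N → ℕ → Ω → Prop}, (∀ i, ∀ t ∈ Finset.Icc 1 T, ∀ᵐ ω ∂P, p i t ω) →
      ∀ᵐ ω ∂P, ∀ t ∈ Finset.Icc 1 T, ∀ i, p i t ω := fun hp =>
    ae_all_iff.2 fun t => by
      by_cases ht : t ∈ Finset.Icc 1 T
      · filter_upwards [ae_all_iff.2 fun i => hp i t ht] with ω h _ using h
      · exact ae_of_all _ fun _ h => absurd h ht
  filter_upwards [key h.state_le, key h.grad_state_le, key h.grad_avg_le] with ω h1 h2 h3
  exact ⟨h1, h2, h3⟩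

lemma norm_avgState_le (hN : 1 ≤ N) {BX : ℝ} {t : ℕ} {ω : Ω}
    (h : ∀ i, ‖Q.state lam eta t ω i‖ ≤ BX) : ‖Q.avgState lam eta t ω‖ ≤ BX := by
  have hN0 : (0 : ℝ) < N := by exact_mod_cast hN
  rw [avgState, norm_smul, Real.norm_of_nonneg (by positivity)]
  calc _ ≤ 1 / (N : ℝ) * ∑ _i : Fin N, BX := by
        gcongr
        exact norm_sum_le_of_le _ fun i _ => h i
    _ = BX := by simp; field_simp

lemma norm_state_sub_avgState_le (t : ℕ) (ω : Ω) (i : Fin N) :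
    ‖Q.state lam eta t ω i - Q.avgState lam eta t ω‖ ≤ ‖dev (Q.state lam eta t ω)‖ :=
  norm_le_pi_norm (dev (Q.state lam eta t ω)) i

lemma pathLength_nonneg (T : ℕ) : 0 ≤ Q.pathLength T :=
  Finset.sum_nonneg fun _ _ => norm_nonneg _

lemma norm_xstar_le {t : ℕ} (ht : 1 ≤ t) : ‖Q.xstar t‖ ≤ ‖Q.xstar 1‖ + Q.pathLength t := by
  induction t, ht using Nat.le_induction with
  | base => simp [pathLength]
  | succ n hn ih =>
    rw [pathLength, Finset.sum_Icc_succ_top (by omega), Nat.add_sub_cancel]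
    have h1 := norm_add_le (Q.xstar (n + 1) - Q.xstar n) (Q.xstar n)
    rw [sub_add_cancel] at h1
    rw [pathLength] at ih
    linarith

lemma pathLength_mono {s t : ℕ} (h : s ≤ t) : Q.pathLength s ≤ Q.pathLength t :=
  Finset.sum_le_sum_of_subset_of_nonneg (Finset.Icc_subset_Icc_right h)
    fun _ _ _ => norm_nonneg _

/-- The sum of the consensus errors along a trajectory. -/
lemma sum_norm_dev_le {w BX Bg : ℝ} {B T : ℕ} {ω : Ω} (hN : 1 ≤ N) (hw : 0 < w)
    (hnet : Q.Network w B) (hBX : 0 ≤ BX) (hb : Q.BoundedAt lam eta BX Bg T ω)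
    (hlam : ∀ t, 1 ≤ t → 0 ≤ lam t) (heta : ∀ t, 1 ≤ t → 0 ≤ eta t) :
    N * w ^ (N * B) * ∑ t ∈ Finset.Icc 1 T, ‖dev (Q.state lam eta t ω)‖ ≤
      (N * B : ℕ) * (2 * BX) + 2 * (N * B : ℕ) * ∑ t ∈ Finset.Icc 1 T, eta t * lam t := by
  have hρ := hnet.mul_pow_le_one hw hN
  have h := sum_le_of_contraction (m := fun t => ‖dev (Q.state lam eta t ω)‖)
    (u := fun t => eta t * lam t) (ρ := 1 - N * w ^ (N * B)) (M := 2 * BX) (K := N * B)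
    (by linarith) (fun t ht => mul_nonneg (heta t ht) (hlam t ht)) (fun t => norm_nonneg _) T
    (by positivity) ?_ ?_
  · simpa using h
  · intro t ht
    refine (pi_norm_le_iff_of_nonneg (by positivity)).2 fun i => ?_
    have h1 := hb.state_le t ht i
    have h2 := norm_avgState_le hN (hb.state_le t ht)
    exact (norm_sub_le _ _).trans (by rw [avgState] at h2; linarith)
  · intro t ht
    refine hnet.norm_dev_add_le hw hN (x := fun t => Q.state lam eta t ω)
      (u := fun t => eta t * lam t) (fun t ht i => ?_) ht
    rw [Q.state_succ lam eta ht, sub_sub_cancel_left, norm_neg, norm_smul,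
      Real.norm_of_nonneg (heta t ht)]
    exact mul_le_mul_of_nonneg_left (norm_clip_le (hlam t ht) _) (heta t ht)

/-- The gradient of a local cost at the state of any agent. -/
lemma norm_gradient_state_le {L BX Bg : ℝ} {T t : ℕ} {ω : Ω} (hN : 1 ≤ N) (hL : 0 ≤ L)
    (hcosts : Q.ConvexCosts L T) (hb : Q.BoundedAt lam eta BX Bg T ω)
    (ht : t ∈ Finset.Icc 1 T) (i j : Fin N) :
    ‖gradient (Q.f j t) (Q.state lam eta t ω i)‖ ≤ Bg + L * (2 * BX) := by
  have h1 := hcosts.smooth j t ht (Q.state lam eta t ω i) (Q.avgState lam eta t ω)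
  have h2 := hb.grad_avg_le t ht j
  have h3 := norm_sub_le (Q.state lam eta t ω i) (Q.avgState lam eta t ω)
  have h4 := hb.state_le t ht i
  have h5 := norm_avgState_le hN (hb.state_le t ht)
  have h6 : L * ‖Q.state lam eta t ω i - Q.avgState lam eta t ω‖ ≤ L * (2 * BX) := by
    gcongr; linarith
  have h7 := norm_add_le (gradient (Q.f j t) (Q.state lam eta t ω i)
    - gradient (Q.f j t) (Q.avgState lam eta t ω)) (gradient (Q.f j t) (Q.avgState lam eta t ω))
  rw [sub_add_cancel] at h7
  linarith

/-- The regret of one agent in one round. -/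
lemma cost_state_sub_le {L BX Bg : ℝ} {T t : ℕ} {ω : Ω} (hN : 1 ≤ N) (hL : 0 ≤ L)
    (hcosts : Q.ConvexCosts L T) (hb : Q.BoundedAt lam eta BX Bg T ω)
    (ht : t ∈ Finset.Icc 1 T) (i : Fin N) (z : Vec d) :
    Q.cost t (Q.state lam eta t ω i) - Q.cost t z ≤
      N * (3 * Bg + L * (2 * BX)) * ‖dev (Q.state lam eta t ω)‖
      + ∑ j, inner ℝ (Q.exactGrad lam eta j t ω) (Q.avgState lam eta t ω - z) := by
  have hterm : ∀ j, Q.f j t (Q.state lam eta t ω i) - Q.f j t z ≤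
      (3 * Bg + L * (2 * BX)) * ‖dev (Q.state lam eta t ω)‖
      + inner ℝ (Q.exactGrad lam eta j t ω) (Q.avgState lam eta t ω - z) := by
    intro j
    have hf := hcosts.convex j t ht
    have hd := hcosts.differentiable j t ht
    have h1 := convexOn_gradient_le hf hd (Q.state lam eta t ω i) (Q.avgState lam eta t ω)
    have h2 := convexOn_gradient_le hf hd (Q.avgState lam eta t ω) (Q.state lam eta t ω j)
    have h3 := convexOn_gradient_le hf hd (Q.state lam eta t ω j) z
    have hdev := fun i => norm_state_sub_avgState_le (Q := Q) (lam := lam) (eta := eta) t ω i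
    set m := ‖dev (Q.state lam eta t ω)‖ with hm
    have hm0 : 0 ≤ m := norm_nonneg _
    have b : ∀ {g u : Vec d} {c : ℝ}, ‖g‖ ≤ c → ‖u‖ ≤ m → inner ℝ g u ≤ c * m :=
      fun {g u c} hg hu => (real_inner_le_norm g u).trans
        (mul_le_mul hg hu (norm_nonneg _) ((norm_nonneg _).trans hg))
    have h4 := b (norm_gradient_state_le hN hL hcosts hb ht i j) (hdev i)
    have h5 := b (hb.grad_avg_le t ht j) (by rw [norm_sub_rev]; exact hdev j)
    have h6 := b (hb.grad_state_le t ht j) (hdev j)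
    have h7 : inner ℝ (gradient (Q.f j t) (Q.state lam eta t ω j)) (Q.state lam eta t ω j - z) =
        inner ℝ (Q.exactGrad lam eta j t ω) (Q.state lam eta t ω j - Q.avgState lam eta t ω)
        + inner ℝ (Q.exactGrad lam eta j t ω) (Q.avgState lam eta t ω - z) := by
      rw [← inner_add_right, sub_add_sub_cancel]; rfl
    linarith
  calc _ = ∑ j, (Q.f j t (Q.state lam eta t ω i) - Q.f j t z) := by
        rw [cost, cost, Finset.sum_sub_distrib]
    _ ≤ _ := Finset.sum_le_sum fun j _ => hterm j
    _ = _ := by rw [Finset.sum_add_distrib]; simp; ring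

/-- The dynamics of the average state. -/
lemma avgState_succ {w : ℝ} {B : ℕ} (hnet : Q.Network w B) {t : ℕ} (ht : 1 ≤ t) (ω : Ω) :
    Q.avgState lam eta (t + 1) ω = Q.avgState lam eta t ω
      - eta t • ((1 / (N : ℝ)) • ∑ i, clip (lam t) (Q.obs lam eta i t ω)) := by
  have h1 : ∑ i, ∑ j, Q.W t i j • Q.state lam eta t ω j = ∑ j, Q.state lam eta t ω j := by
    rw [Finset.sum_comm]
    exact Finset.sum_congr rfl fun j _ => by rw [← Finset.sum_smul, hnet.col_sum t ht, one_smul]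
  simp only [avgState, Q.state_succ lam eta ht, Finset.sum_sub_distrib, h1, smul_sub,
    ← Finset.smul_sum]
  rw [smul_comm]

/-- The regret along a trajectory, in terms of the consensus errors and of the noise. -/
lemma regret_le {L w A BX Bg : ℝ} {B T : ℕ} {ω : Ω} (hN : 1 ≤ N) (hT : 1 ≤ T) (hL : 0 ≤ L)
    (hBX : 0 ≤ BX) (hnet : Q.Network w B) (hcosts : Q.ConvexCosts L T)
    (hb : Q.BoundedAt lam eta BX Bg T ω) (hlam : ∀ t, 1 ≤ t → 0 ≤ lam t)
    (heta : ∀ t, 1 ≤ t → 0 < eta t) (hanti : ∀ t, 1 ≤ t → eta (t + 1) ≤ eta t)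
    (hA : BX + eta T * lam T ≤ A) :
    Q.regret lam eta T ω ≤ N * (N * (3 * Bg + L * (2 * BX))
        * ∑ t ∈ Finset.Icc 1 T, ‖dev (Q.state lam eta t ω)‖
      + N * (1 / eta T * (A ^ 2 / 2 + 2 * A * (‖Q.xstar 1‖ + Q.pathLength T))
        + ∑ t ∈ Finset.Icc 1 T, eta t * lam t ^ 2 / 2)
      + Q.noiseSum lam eta T ω) := by
  have hN0 : (0 : ℝ) < N := by exact_mod_cast hN
  set g : ℕ → Vec d := fun t => (1 / (N : ℝ)) • ∑ i, clip (lam t) (Q.obs lam eta i t ω) with hg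
  have hgn : ∀ t, 1 ≤ t → ‖g t‖ ≤ lam t := fun t ht => by
    rw [hg, norm_smul, Real.norm_of_nonneg (by positivity)]
    calc _ ≤ 1 / (N : ℝ) * ∑ _i : Fin N, lam t := by
          gcongr
          exact norm_sum_le_of_le _ fun i _ => norm_clip_le (hlam t ht) _
      _ = lam t := by simp; field_simp
  have hAvg : ∀ t ∈ Finset.Icc 1 T, ‖Q.avgState lam eta t ω‖ ≤ BX := fun t ht =>
    norm_avgState_le hN (hb.state_le t ht)
  have hul : 0 ≤ eta T * lam T := mul_nonneg (heta T hT).le (hlam T hT)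
  have hstep := sum_inner_step_le (fun t => 1 / eta t) (fun t => Q.avgState lam eta t ω) Q.xstar g
    (A := A) (by linarith) T hT (fun t ht => one_div_pos.2 (heta t ht))
    (fun t ht => one_div_le_one_div_of_le (heta (t + 1) (by omega)) (hanti t ht)) (by
      intro t ht
      rcases eq_or_ne t (T + 1) with rfl | h
      · rw [avgState_succ hnet hT]
        have h1 := hAvg T (Finset.mem_Icc.2 ⟨hT, le_rfl⟩)
        have h2 : ‖eta T • g T‖ ≤ eta T * lam T := by
          rw [norm_smul, Real.norm_of_nonneg (heta T hT).le]
          exact mul_le_mul_of_nonneg_left (hgn T hT) (heta T hT).le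
        exact (norm_sub_le _ _).trans (by linarith)
      · refine (hAvg t ?_).trans (by linarith)
        simp only [Finset.mem_Icc] at ht ⊢
        omega) (by
      intro t ht
      have := heta t ht
      rw [avgState_succ hnet ht, sub_sub_cancel, smul_smul, one_div_mul_cancel this.ne', one_smul])
  have hsq : ∑ t ∈ Finset.Icc 1 T, ‖g t‖ ^ 2 / (2 * (1 / eta t)) ≤
      ∑ t ∈ Finset.Icc 1 T, eta t * lam t ^ 2 / 2 := by
    refine Finset.sum_le_sum fun t ht => ?_
    have ht1 := (Finset.mem_Icc.1 ht).1
    have h1 := heta t ht1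
    have h2 := hgn t ht1
    have e : ‖g t‖ ^ 2 / (2 * (1 / eta t)) = eta t * ‖g t‖ ^ 2 / 2 := by field_simp
    rw [e]
    gcongr
  have hround : ∀ t ∈ Finset.Icc 1 T,
      ∑ j, inner ℝ (Q.exactGrad lam eta j t ω) (Q.avgState lam eta t ω - Q.xstar t)
      = N * inner ℝ (g t) (Q.avgState lam eta t ω - Q.xstar t)
        + ∑ i, inner ℝ (Q.exactGrad lam eta i t ω - clip (lam t) (Q.obs lam eta i t ω))
          (Q.avgState lam eta t ω - Q.xstar t) := by
    intro t ht
    rw [hg, real_inner_smul_left, ← mul_assoc, mul_one_div_cancel hN0.ne', one_mul, sum_inner,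
      ← Finset.sum_add_distrib]
    exact Finset.sum_congr rfl fun i _ => by rw [← inner_add_left]; simp
  rw [regret]
  calc _ ≤ ∑ _i : Fin N, ∑ t ∈ Finset.Icc 1 T,
        (N * (3 * Bg + L * (2 * BX)) * ‖dev (Q.state lam eta t ω)‖
        + (N * inner ℝ (g t) (Q.avgState lam eta t ω - Q.xstar t)
        + ∑ i, inner ℝ (Q.exactGrad lam eta i t ω - clip (lam t) (Q.obs lam eta i t ω))
          (Q.avgState lam eta t ω - Q.xstar t))) := by
        refine Finset.sum_le_sum fun i _ => Finset.sum_le_sum fun t ht => ?_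
        rw [← hround t ht]
        exact cost_state_sub_le hN hL hcosts hb ht i _
    _ = N * (N * (3 * Bg + L * (2 * BX)) * ∑ t ∈ Finset.Icc 1 T, ‖dev (Q.state lam eta t ω)‖
        + N * ∑ t ∈ Finset.Icc 1 T, inner ℝ (g t) (Q.avgState lam eta t ω - Q.xstar t)
        + Q.noiseSum lam eta T ω) := by
        simp only [Finset.sum_const, Finset.card_univ, Fintype.card_fin, nsmul_eq_mul,
          Finset.sum_add_distrib, ← Finset.mul_sum, noiseSum]
        ring
    _ ≤ _ := by
        gcongr
        refine hstep.trans ?_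
        rw [pathLength]
        gcongr

/-- The regrets along two bounded trajectories differ by `O(T)`, whatever the comparators. -/
lemma regret_sub_regret_le {L BX Bg : ℝ} {T : ℕ} {ω ω' : Ω} (hN : 1 ≤ N) (hL : 0 ≤ L)
    (hcosts : Q.ConvexCosts L T) (hb : Q.BoundedAt lam eta BX Bg T ω)
    (hb' : Q.BoundedAt lam eta BX Bg T ω') :
    Q.regret lam eta T ω - Q.regret lam eta T ω' ≤
      N * (T * (N * ((Bg + L * (2 * BX)) * (2 * BX)))) := by
  rw [regret, regret, ← Finset.sum_sub_distrib]
  simp only [← Finset.sum_sub_distrib]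
  calc _ ≤ ∑ _i : Fin N, ∑ _t ∈ Finset.Icc 1 T, ∑ _j : Fin N,
        (Bg + L * (2 * BX)) * (2 * BX) := by
        refine Finset.sum_le_sum fun i _ => Finset.sum_le_sum fun t ht => ?_
        rw [sub_sub_sub_cancel_right, cost, cost, ← Finset.sum_sub_distrib]
        refine Finset.sum_le_sum fun j _ => ?_
        refine (convexOn_gradient_le (hcosts.convex j t ht) (hcosts.differentiable j t ht)
          _ _).trans ((real_inner_le_norm _ _).trans ?_)
        have h1 := norm_gradient_state_le hN hL hcosts hb ht i j
        have h2 := norm_sub_le (Q.state lam eta t ω i) (Q.state lam eta t ω' i)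
        have h3 := hb.state_le t ht i
        have h4 := hb'.state_le t ht i
        exact mul_le_mul h1 (by linarith) (norm_nonneg _) ((norm_nonneg _).trans h1)
    _ = _ := by simp

end OnlineProblem

section Schedules

variable {a b p Bg : ℝ} {t : ℕ}

lemma rpow_add_half (hp : 1 < p) (hT : 1 ≤ t) :
    (t : ℝ) ^ ((p + 1) / (2 * p)) = (t : ℝ) ^ (1 / (2 * p)) * √(t : ℝ) := by
  have h0 : (0 : ℝ) < t := by exact_mod_cast hT
  rw [Real.sqrt_eq_rpow, ← Real.rpow_add h0]
  congr 1
  field_simp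
  ring

lemma clipLevel_pos (hBg : 0 < Bg) (α : ℝ) (ht : 1 ≤ t) : 0 < clipLevel Bg α t := by
  have h0 : (0 : ℝ) < t := by exact_mod_cast ht
  unfold clipLevel
  positivity

lemma clipLevel_mono (hBg : 0 < Bg) {α : ℝ} (hα : 0 ≤ α) {s : ℕ} (h : s ≤ t) :
    clipLevel Bg α s ≤ clipLevel Bg α t := by
  unfold clipLevel
  gcongr

lemma le_clipLevel (hBg : 0 < Bg) {α : ℝ} (hα : 0 ≤ α) (ht : 1 ≤ t) :
    2 * Bg ≤ clipLevel Bg α t := by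
  simpa [clipLevel] using clipLevel_mono hBg hα ht

lemma min_mul_le_affine (ht : 1 ≤ t) : min a (a + b) * t ≤ a * t + b := by
  have h1 : (1 : ℝ) ≤ t := by exact_mod_cast ht
  rcases le_total 0 b with hb | hb
  · nlinarith [min_le_left a (a + b)]
  · nlinarith [min_le_right a (a + b)]

lemma affine_pos (ha : 0 < a) (hab : 0 < a + b) (ht : 1 ≤ t) : 0 < a * t + b := by
  have h1 : (1 : ℝ) ≤ t := by exact_mod_cast ht
  nlinarith

lemma affine_le_mul (ht : 1 ≤ t) : a * t + b ≤ (a + |b|) * t := by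
  have h1 : (1 : ℝ) ≤ t := by exact_mod_cast ht
  nlinarith [le_abs_self b, abs_nonneg b]

lemma stepSize_pos (ha : 0 < a) (hab : 0 < a + b) (κ : ℝ) (ht : 1 ≤ t) :
    0 < stepSize a b κ t :=
  one_div_pos.2 (Real.rpow_pos_of_pos (affine_pos ha hab ht) κ)

lemma stepSize_succ_le (ha : 0 < a) (hab : 0 < a + b) {κ : ℝ} (hκ : 0 ≤ κ) (ht : 1 ≤ t) :
    stepSize a b κ (t + 1) ≤ stepSize a b κ t := by
  have h := affine_pos ha hab ht
  refine one_div_le_one_div_of_le (Real.rpow_pos_of_pos h κ) ?_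
  refine Real.rpow_le_rpow h.le ?_ hκ
  push_cast
  linarith

lemma one_div_stepSize_le (ha : 0 < a) (hab : 0 < a + b) {κ : ℝ} (hκ : 0 ≤ κ) (ht : 1 ≤ t) :
    1 / stepSize a b κ t ≤ (a + |b|) ^ κ * (t : ℝ) ^ κ := by
  rw [stepSize, one_div_one_div, ← Real.mul_rpow (by positivity) (by positivity)]
  exact Real.rpow_le_rpow (affine_pos ha hab ht).le (affine_le_mul ht) hκ

lemma stepSize_mul_clipLevel_le (ha : 0 < a) (hab : 0 < a + b) (hp : 1 < p) (hBg : 0 < Bg)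
    (ht : 1 ≤ t) :
    stepSize a b ((p + 1) / (2 * p)) t * clipLevel Bg (1 / (2 * p)) t ≤
      2 * Bg / (min a (a + b)) ^ ((p + 1) / (2 * p)) * (1 / √(t : ℝ)) := by
  have h0 : (0 : ℝ) < t := by exact_mod_cast ht
  have hc : 0 < min a (a + b) := lt_min ha hab
  have h1 : (min a (a + b)) ^ ((p + 1) / (2 * p)) * ((t : ℝ) ^ (1 / (2 * p)) * √(t : ℝ))
      ≤ (a * t + b) ^ ((p + 1) / (2 * p)) := by
    rw [← rpow_add_half hp ht, ← Real.mul_rpow hc.le h0.le]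
    exact Real.rpow_le_rpow (by positivity) (min_mul_le_affine ht) (by positivity)
  have hs : 0 < √(t : ℝ) := Real.sqrt_pos.2 h0
  have hα : 0 < (t : ℝ) ^ (1 / (2 * p)) := by positivity
  have hm : 0 < (min a (a + b)) ^ ((p + 1) / (2 * p)) := by positivity
  have hq := Real.rpow_pos_of_pos (affine_pos ha hab ht) ((p + 1) / (2 * p))
  rw [stepSize, clipLevel, div_mul_div_comm, one_div_mul_eq_div, div_le_div_iff₀ hq (by positivity)]
  nlinarith

/-- The exponents accumulated in the noise bound sum to `O(√T)`. -/
lemma sum_noise_exponent_le (hp : 1 < p) (hp2 : p ≤ 2) (hBg : 0 < Bg) {N D σ : ℝ} (hN : 0 < N)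
    (hD : 0 < D) (hσ : 0 ≤ σ) {lam : ℕ → ℝ} (hlam : lam = clipLevel Bg (1 / (2 * p))) {θ : ℝ}
    {T : ℕ} (hT : 1 ≤ T) (hθ : θ = 1 / (2 * N * lam T * D)) :
    ∑ t ∈ Finset.Icc 1 T, (θ * D * (lam t / 2) ^ (1 - p)
        + 4 * N * θ ^ 2 * D ^ 2 * lam t ^ (2 - p)) * (N * σ ^ p) ≤
      (2 * (Bg ^ (1 - p) / (4 * N * Bg)) + 1 / N * (2 * Bg) ^ (-p)) * (N * σ ^ p) * √(T : ℝ) := by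
  have hα : 0 < 1 / (2 * p) := by positivity
  have hT0 : (0 : ℝ) < T := by exact_mod_cast hT
  have hlT : 0 < lam T := by rw [hlam]; exact clipLevel_pos hBg _ hT
  have hterm : ∀ t ∈ Finset.Icc 1 T, θ * D * (lam t / 2) ^ (1 - p)
        + 4 * N * θ ^ 2 * D ^ 2 * lam t ^ (2 - p) ≤
      Bg ^ (1 - p) / (4 * N * Bg) * (1 / √(t : ℝ)) + 1 / N * (2 * Bg) ^ (-p) * (1 / √(T : ℝ)) := by
    intro t ht
    obtain ⟨ht1, htT⟩ := Finset.mem_Icc.1 ht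
    have ht0 : (0 : ℝ) < t := by exact_mod_cast ht1
    have hlt : 0 < lam t := by rw [hlam]; exact clipLevel_pos hBg _ ht1
    have hle : lam t ≤ lam T := by rw [hlam]; exact clipLevel_mono hBg hα.le htT
    refine add_le_add ?_ ?_
    · have e1 : θ * D = 1 / (2 * N * lam T) := by rw [hθ]; field_simp
      have e2 : (lam t / 2) ^ (1 - p) =
          Bg ^ (1 - p) * ((t : ℝ) ^ (1 / (2 * p)) * (1 / √(t : ℝ))) := by
        have : lam t / 2 = Bg * (t : ℝ) ^ (1 / (2 * p)) := by rw [hlam, clipLevel]; ring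
        rw [this, Real.mul_rpow hBg.le (by positivity), ← Real.rpow_mul ht0.le, one_div (√(t : ℝ)),
          Real.sqrt_eq_rpow, ← Real.rpow_neg ht0.le, ← Real.rpow_add ht0]
        congr 2
        field_simp
        ring
      have e3 : (t : ℝ) ^ (1 / (2 * p)) ≤ (T : ℝ) ^ (1 / (2 * p)) := by gcongr
      rw [e1, e2]
      have e4 : lam T = 2 * Bg * (T : ℝ) ^ (1 / (2 * p)) := by rw [hlam, clipLevel]
      have hTα : 0 < (T : ℝ) ^ (1 / (2 * p)) := by positivity
      calc _ ≤ 1 / (2 * N * lam T) *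
              (Bg ^ (1 - p) * ((T : ℝ) ^ (1 / (2 * p)) * (1 / √(t : ℝ)))) := by
            gcongr
        _ = _ := by rw [e4]; field_simp; ring
    · have e1 : 4 * N * θ ^ 2 * D ^ 2 = 1 / N * (1 / lam T ^ 2) := by rw [hθ]; field_simp; ring
      have e2 : lam t ^ (2 - p) ≤ lam T ^ (2 - p) := by gcongr
      have e3 : 1 / lam T ^ 2 * lam T ^ (2 - p) = (2 * Bg) ^ (-p) * (1 / √(T : ℝ)) := by
        have h1 : 1 / lam T ^ 2 = lam T ^ (-2 : ℝ) := by
          rw [Real.rpow_neg hlT.le, one_div]; norm_cast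
        rw [h1, ← Real.rpow_add hlT, hlam, clipLevel,
          Real.mul_rpow (by positivity) (by positivity), ← Real.rpow_mul hT0.le,
          one_div (√(T : ℝ)), Real.sqrt_eq_rpow, ← Real.rpow_neg hT0.le]
        congr 2
        · ring
        · field_simp; ring
      rw [e1]
      calc _ ≤ 1 / N * (1 / lam T ^ 2) * lam T ^ (2 - p) := by gcongr
        _ = 1 / N * (1 / lam T ^ 2 * lam T ^ (2 - p)) := by ring
        _ = _ := by rw [e3]; ring
  rw [← Finset.sum_mul, mul_right_comm _ _ (√(T : ℝ))]
  gcongr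
  refine (Finset.sum_le_sum hterm).trans ?_
  rw [Finset.sum_add_distrib, ← Finset.mul_sum, Finset.sum_const, Nat.card_Icc, nsmul_eq_mul]
  have h1 := sum_inv_sqrt_le T
  have h2 : ((T + 1 - 1 : ℕ) : ℝ) * (1 / N * (2 * Bg) ^ (-p) * (1 / √(T : ℝ)))
      = 1 / N * (2 * Bg) ^ (-p) * √(T : ℝ) := by
    have hs : 0 < √(T : ℝ) := Real.sqrt_pos.2 hT0
    have hs2 : (T : ℝ) = √(T : ℝ) * √(T : ℝ) := (Real.mul_self_sqrt hT0.le).symm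
    rw [Nat.add_sub_cancel]
    nth_rewrite 1 [hs2]
    field_simp
  rw [h2, add_mul]
  have h3 : 0 ≤ Bg ^ (1 - p) / (4 * N * Bg) := by positivity
  nlinarith

end Schedules

section Main

variable {N B : ℕ} {p σ L BX Bg w a b R : ℝ} {lam eta : ℕ → ℝ}

/-- The regret along a trajectory, for step sizes and clipping levels of the right orders. -/
lemma regret_le_of_schedule {d : ℕ} {Ω : Type*} {Q : OnlineProblem N d Ω} {T : ℕ} {ω : Ω}
    {cu cG τ V D : ℝ} (hN : 1 ≤ N) (hT : 1 ≤ T) (hL : 0 ≤ L) (hBX : 0 ≤ BX) (hw : 0 < w)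
    (hnet : Q.Network w B) (hcosts : Q.ConvexCosts L T) (hω : Q.BoundedAt lam eta BX Bg T ω)
    (hlampos : ∀ t, 1 ≤ t → 0 < lam t) (hetapos : ∀ t, 1 ≤ t → 0 < eta t)
    (hanti : ∀ t, 1 ≤ t → eta (t + 1) ≤ eta t) (hmono : ∀ t, t ≤ T → lam t ≤ lam T)
    (hcu : 0 ≤ cu) (hul : ∀ t, 1 ≤ t → eta t * lam t ≤ cu * (1 / √(t : ℝ)))
    (hG : 1 / eta T ≤ cG * V) (hτ : 1 ≤ τ) (hV : V = τ * √(T : ℝ))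
    (hlT : lam T = 2 * Bg * τ) (hD : ‖Q.xstar 1‖ + Q.pathLength T ≤ D) (hcG : 0 ≤ cG) :
    Q.regret lam eta T ω ≤ N * (N * (3 * Bg + L * (2 * BX))
        * (((N * B : ℕ) * (2 * BX) + 2 * (N * B : ℕ) * (cu * 2)) / (N * w ^ (N * B)) * V)
      + N * (cG * V * ((BX + cu) ^ 2 / 2 + 2 * (BX + cu) * D) + 2 * cu * Bg * V)
      + Q.noiseSum lam eta T ω) := by
  have hN0 : (0 : ℝ) < N := by exact_mod_cast hN
  have hT0 : (1 : ℝ) ≤ T := by exact_mod_cast hT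
  have hs1 : 1 ≤ √(T : ℝ) := Real.one_le_sqrt.2 hT0
  have hsV : √(T : ℝ) ≤ V := by rw [hV]; exact le_mul_of_one_le_left (by positivity) hτ
  have hV0 : 0 ≤ V := by linarith
  have hBg : 0 ≤ Bg := by
    have := hlampos T hT
    rw [hlT] at this
    nlinarith
  have hreg := OnlineProblem.regret_le (A := BX + cu) hN hT hL hBX hnet hcosts hω
    (fun t ht => (hlampos t ht).le) hetapos hanti (by
      have h1 := hul T hT
      have h2 : cu * (1 / √(T : ℝ)) ≤ cu :=
        mul_le_of_le_one_right hcu ((div_le_one (by positivity)).2 hs1)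
      linarith)
  have hdev := OnlineProblem.sum_norm_dev_le hN hw hnet hBX hω
    (fun t ht => (hlampos t ht).le) (fun t ht => (hetapos t ht).le)
  have hsumu : ∑ t ∈ Finset.Icc 1 T, eta t * lam t ≤ cu * (2 * √(T : ℝ)) := by
    calc _ ≤ ∑ t ∈ Finset.Icc 1 T, cu * (1 / √(t : ℝ)) :=
          Finset.sum_le_sum fun t ht => hul t (Finset.mem_Icc.1 ht).1
      _ ≤ _ := by rw [← Finset.mul_sum]; gcongr; exact sum_inv_sqrt_le T
  have hM : ∑ t ∈ Finset.Icc 1 T, ‖dev (Q.state lam eta t ω)‖ ≤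
      ((N * B : ℕ) * (2 * BX) + 2 * (N * B : ℕ) * (cu * 2)) / (N * w ^ (N * B)) * V := by
    have hβ : 0 < N * w ^ (N * B) := by positivity
    rw [div_mul_eq_mul_div, le_div_iff₀ hβ, mul_comm]
    refine hdev.trans ?_
    have h1 : (N * B : ℕ) * (2 * BX) * 1 ≤ (N * B : ℕ) * (2 * BX) * V :=
      mul_le_mul_of_nonneg_left (by linarith) (by positivity)
    have h2 : 2 * (N * B : ℕ) * ∑ t ∈ Finset.Icc 1 T, eta t * lam t ≤
        2 * (N * B : ℕ) * (cu * (2 * V)) :=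
      mul_le_mul_of_nonneg_left (hsumu.trans (by gcongr)) (by positivity)
    linarith
  have hquad : ∑ t ∈ Finset.Icc 1 T, eta t * lam t ^ 2 / 2 ≤ 2 * cu * Bg * V := by
    calc _ ≤ ∑ t ∈ Finset.Icc 1 T, eta t * lam t * (lam T / 2) := by
          refine Finset.sum_le_sum fun t ht => ?_
          have ht1 := (Finset.mem_Icc.1 ht).1
          have h2 := hmono t (Finset.mem_Icc.1 ht).2
          have h3 : 0 ≤ eta t * lam t := mul_nonneg (hetapos t ht1).le (hlampos t ht1).le
          nlinarith
      _ ≤ cu * (2 * √(T : ℝ)) * (lam T / 2) := by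
          rw [← Finset.sum_mul]
          exact mul_le_mul_of_nonneg_right hsumu (half_pos (hlampos T hT)).le
      _ = _ := by rw [hlT, hV]; ring
  have hx0 : 0 ≤ ‖Q.xstar 1‖ + Q.pathLength T :=
    add_nonneg (norm_nonneg _) (OnlineProblem.pathLength_nonneg T)
  refine hreg.trans ?_
  gcongr

/-- A high-probability regret bound in which the path length multiplies the confidence term. -/
lemma exists_regret_bound_product (hN : 1 ≤ N)
    (hp : 1 < p) (hp2 : p ≤ 2) (hσ : 0 < σ) (hL : 0 ≤ L) (hBX : 0 < BX) (hBg : 0 < Bg)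
    (hw : 0 < w) (ha : 0 < a) (hab : 0 < a + b) (hR : 0 ≤ R)
    (hlam : lam = clipLevel Bg (1 / (2 * p)))
    (heta : eta = stepSize a b ((p + 1) / (2 * p))) :
    ∃ C : ℝ, 0 < C ∧
      ∀ (d : ℕ) (Ω : Type*) [MeasurableSpace Ω] (P : Measure Ω) [IsProbabilityMeasure P]
        (Q : OnlineProblem N d Ω) (T : ℕ), 1 ≤ T →
        Q.ConvexSetting P lam eta p σ L BX Bg w B T →
        (∀ i, ‖Q.init i - Q.xstar 1‖ ≤ R) →
        ∀ δ : ℝ, 0 < δ → δ < 1 →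
          P {ω | C * ((1 + Q.pathLength T) * ((T : ℝ) ^ ((p + 1) / (2 * p))
            + (T : ℝ) ^ (1 / (2 * p)) * Real.log (1 / δ))) < Q.regret lam eta T ω}
            ≤ ENNReal.ofReal δ := by
  have hN0 : (0 : ℝ) < N := by exact_mod_cast hN
  set α := 1 / (2 * p) with hα
  set κ := (p + 1) / (2 * p) with hκ
  have hα0 : 0 < α := by positivity
  have hκ0 : 0 < κ := by positivity
  have hc : 0 < min a (a + b) := lt_min ha hab
  set cu := 2 * Bg / (min a (a + b)) ^ κ with hcu
  have hcu0 : 0 < cu := by positivity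
  set cM := ((N * B : ℕ) * (2 * BX) + 2 * (N * B : ℕ) * (cu * 2)) / (N * w ^ (N * B)) with hcM
  have hcM0 : 0 ≤ cM := by positivity
  set A := BX + cu with hA
  have hA0 : 0 < A := by positivity
  set cG := (a + |b|) ^ κ with hcG
  have hcG0 : 0 ≤ cG := by positivity
  set cA := (2 * (Bg ^ (1 - p) / (4 * N * Bg)) + 1 / N * (2 * Bg) ^ (-p)) * (N * σ ^ p) with hcA
  have hcA0 : 0 ≤ cA := by positivity
  set D0 := 1 + 2 * BX + R with hD0
  have hD00 : 0 < D0 := by positivity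
  refine ⟨N * (N * (3 * Bg + L * (2 * BX)) * cM
      + N * (cG * (A ^ 2 / 2 + 2 * A * D0) + 2 * cu * Bg) + 4 * N * Bg * D0 * (cA + 1)),
    by positivity, ?_⟩
  intro d Ω _ P _ Q T hT hQ hinit δ hδ hδ1
  have hT0 : (1 : ℝ) ≤ T := by exact_mod_cast hT
  have hPL : 0 ≤ Q.pathLength T := OnlineProblem.pathLength_nonneg T
  have hlampos : ∀ t, 1 ≤ t → 0 < lam t := fun t ht => hlam ▸ clipLevel_pos hBg _ ht
  have hetapos : ∀ t, 1 ≤ t → 0 < eta t := fun t ht => heta ▸ stepSize_pos ha hab _ ht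
  have hul : ∀ t, 1 ≤ t → eta t * lam t ≤ cu * (1 / √(t : ℝ)) := fun t ht => by
    rw [hlam, heta]; exact stepSize_mul_clipLevel_le ha hab hp hBg ht
  have hℓ : 0 < Real.log (1 / δ) := Real.log_pos (by rw [lt_div_iff₀ hδ]; linarith)
  have hb := hQ.bounded.ae_boundedAt
  have hx1 : ‖Q.xstar 1‖ ≤ R + BX := by
    obtain ⟨ω, hω⟩ := hb.exists
    have h1 : ‖Q.init ⟨0, hN⟩‖ ≤ BX :=
      hω.state_le 1 (Finset.mem_Icc.2 ⟨le_rfl, hT⟩) ⟨0, hN⟩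
    have h2 := hinit ⟨0, hN⟩
    have h3 := norm_sub_le (Q.init ⟨0, hN⟩) (Q.init ⟨0, hN⟩ - Q.xstar 1)
    rw [sub_sub_cancel] at h3
    linarith
  set D := D0 * (1 + Q.pathLength T) with hD
  have hDpos : 0 < D := by positivity
  have hD1 : 2 * BX + R + Q.pathLength T ≤ D := by
    have h1 : Q.pathLength T ≤ D0 * Q.pathLength T :=
      le_mul_of_one_le_left hPL (by linarith)
    linarith
  have hlamG : ∀ t, 1 ≤ t → 2 * Bg ≤ lam t := fun t ht => by
    rw [hlam]; exact le_clipLevel hBg hα0.le ht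
  set θ := 1 / (2 * N * lam T * D) with hθ
  have hlT := hlampos T hT
  have hθ0 : 0 < θ := by positivity
  obtain ⟨hn1, hn2, hn3⟩ := OnlineProblem.integral_exp_noiseSum_le (P := P) (D := D) (θ := θ) hL hp
    hp2 hDpos.le hθ0.le hQ.costs hQ.noise hσ.le (fun t ht => hlampos t (Finset.mem_Icc.1 ht).1)
    (fun t ht => by
      have h1 : lam t ≤ lam T := by
        rw [hlam]; exact clipLevel_mono hBg hα0.le (Finset.mem_Icc.1 ht).2
      rw [hθ, one_div_mul_eq_div, div_le_one (by positivity)]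
      gcongr)
    (fun i t ht => by
      filter_upwards [hb] with ω hω
      have := hlamG t (Finset.mem_Icc.1 ht).1
      linarith [hω.grad_state_le t ht i])
    (fun t ht => by
      filter_upwards [hb] with ω hω
      have h1 := OnlineProblem.norm_avgState_le hN (hω.state_le t ht)
      have h2 := Q.norm_xstar_le (Finset.mem_Icc.1 ht).1
      have h3 := Q.pathLength_mono (Finset.mem_Icc.1 ht).2
      exact (norm_sub_le _ _).trans (by linarith))
  have hn4 := hn3.trans (Real.exp_le_exp.2
    (sum_noise_exponent_le hp hp2 hBg hN0 hDpos hσ.le hlam hT hθ))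
  have hn5 := OnlineProblem.measure_noiseSum_gt_le hθ0 hδ hn1 hn2 hn4
  refine le_trans (measure_mono_ae ?_) hn5
  filter_upwards [hb] with ω hω hlt
  by_contra hcon
  refine absurd hlt (not_lt.2 ?_)
  have hcon' := (not_le.1 hcon).le
  have hTα : 1 ≤ (T : ℝ) ^ α := Real.one_le_rpow hT0 hα0.le
  have hTκ : (T : ℝ) ^ κ = (T : ℝ) ^ α * √(T : ℝ) := rpow_add_half hp hT
  have hreg := regret_le_of_schedule hN hT hL hBX.le hw hQ.network hQ.costs hω hlampos hetapos
    (fun t ht => by rw [heta]; exact stepSize_succ_le ha hab hκ0.le ht)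
    (fun t ht => by rw [hlam]; exact clipLevel_mono hBg hα0.le ht) hcu0.le hul
    (by rw [heta]; exact one_div_stepSize_le ha hab hκ0.le hT) hTα hTκ (by rw [hlam]; rfl)
    (show ‖Q.xstar 1‖ + Q.pathLength T ≤ D by linarith) hcG0
  have hnoise : Q.noiseSum lam eta T ω ≤
      4 * N * Bg * D * (cA * (T : ℝ) ^ κ + (T : ℝ) ^ α * Real.log (1 / δ)) := by
    have h1 : lam T = 2 * Bg * (T : ℝ) ^ α := by rw [hlam]; rfl
    refine hcon'.trans_eq ?_
    rw [hθ, div_div_eq_mul_div, div_one, h1, hTκ]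
    ring
  set V := (T : ℝ) ^ κ with hV
  set U := (T : ℝ) ^ α * Real.log (1 / δ) with hU
  have hU0 : 0 ≤ U := by positivity
  have hV0 : 0 ≤ V := by positivity
  set F := 1 + Q.pathLength T with hF
  have hF1 : 1 ≤ F := by linarith
  have hF0 : 0 ≤ F := zero_le_one.trans hF1
  have hFV : F * V ≤ F * (V + U) := mul_le_mul_of_nonneg_left (le_add_of_nonneg_right hU0) hF0
  have hFU : F * U ≤ F * (V + U) := mul_le_mul_of_nonneg_left (le_add_of_nonneg_left hV0) hF0
  have hVU : V ≤ F * (V + U) := (le_mul_of_one_le_left hV0 hF1).trans hFV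
  refine hreg.trans ((mul_le_mul_of_nonneg_left ?_ hN0.le).trans_eq (mul_assoc _ _ _).symm)
  rw [add_mul, add_mul]
  refine add_le_add (add_le_add ?_ ?_) ?_
  · rw [← mul_assoc]
    exact mul_le_mul_of_nonneg_left hVU (by positivity)
  · refine (mul_le_mul_of_nonneg_left ?_ hN0.le).trans_eq (mul_assoc _ _ _).symm
    rw [add_mul]
    refine add_le_add ?_ (mul_le_mul_of_nonneg_left hVU (by positivity))
    calc cG * V * (A ^ 2 / 2 + 2 * A * D) = cG * (A ^ 2 / 2 * V + 2 * A * D0 * (F * V)) := by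
          rw [hD]; ring
      _ ≤ cG * (A ^ 2 / 2 * (F * (V + U)) + 2 * A * D0 * (F * (V + U))) := by gcongr
      _ = _ := by ring
  · refine hnoise.trans ?_
    calc 4 * N * Bg * D * (cA * V + U) = 4 * N * Bg * D0 * (cA * (F * V) + F * U) := by
          rw [hD]; ring
      _ ≤ 4 * N * Bg * D0 * (cA * (F * (V + U)) + F * (V + U)) := by gcongr
      _ = _ := by ring

lemma one_sub_le_measure {Ω : Type*} [MeasurableSpace Ω] {P : Measure Ω} [IsProbabilityMeasure P]
    {X : Ω → ℝ} {c δ : ℝ} (hδ : 0 ≤ δ) (h : P {ω | c < X ω} ≤ ENNReal.ofReal δ) :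
    ENNReal.ofReal (1 - δ) ≤ P {ω | X ω ≤ c} := by
  rw [ENNReal.ofReal_sub _ hδ, ENNReal.ofReal_one, tsub_le_iff_right]
  calc (1 : ENNReal) = P Set.univ := measure_univ.symm
    _ ≤ P ({ω | X ω ≤ c} ∪ {ω | c < X ω}) := measure_mono fun ω _ => le_or_gt (X ω) c
    _ ≤ _ := measure_union_le _ _
    _ ≤ _ := by gcongr

/-- The high-probability regret bound, with a constant independent of the problem instance. -/
theorem exists_regret_bound (hN : 1 ≤ N)
    (hp : 1 < p) (hp2 : p ≤ 2) (hσ : 0 < σ) (hL : 0 ≤ L) (hBX : 0 < BX) (hBg : 0 < Bg)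
    (hw : 0 < w) (ha : 0 < a) (hab : 0 < a + b)
    (hlam : lam = clipLevel Bg (1 / (2 * p)))
    (heta : eta = stepSize a b ((p + 1) / (2 * p))) :
    ∃ C : ℝ, 0 < C ∧
      ∀ (d : ℕ) (Ω : Type*) [MeasurableSpace Ω] (P : Measure Ω) [IsProbabilityMeasure P]
        (Q : OnlineProblem N d Ω) (T : ℕ), 1 ≤ T →
        Q.ConvexSetting P lam eta p σ L BX Bg w B T →
        (∀ i, ‖Q.init i - Q.xstar 1‖ ≤ R) →
        ∀ δ : ℝ, 0 < δ → δ < 1 →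
          ENNReal.ofReal (1 - δ) ≤
            P {ω | Q.regret lam eta T ω ≤
              C * ((T : ℝ) ^ ((1 + p) / (2 * p)) * (1 + Q.pathLength T + Real.log (1 / δ)))} := by
  obtain ⟨C, hC, h⟩ := exists_regret_bound_product (B := B) (R := |R|) hN hp hp2 hσ hL hBX hBg hw ha
    hab (abs_nonneg R) hlam heta
  set C' := N * (N * ((Bg + L * (2 * BX)) * (2 * BX))) with hC'
  have hC'0 : 0 ≤ C' := by positivity
  refine ⟨2 * C + C', by positivity, ?_⟩
  intro d Ω _ P _ Q T hT hQ hinit δ hδ hδ1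
  have h := h d Ω P Q T hT hQ fun i => (hinit i).trans (le_abs_self R)
  rw [add_comm 1 p]
  have hT0 : (1 : ℝ) ≤ T := by exact_mod_cast hT
  have hs1 : 1 ≤ √(T : ℝ) := Real.one_le_sqrt.2 hT0
  have hα0 : 0 < 1 / (2 * p) := by positivity
  have hTα : 1 ≤ (T : ℝ) ^ (1 / (2 * p)) := Real.one_le_rpow hT0 hα0.le
  have hTκ := rpow_add_half hp hT
  have hPL : 0 ≤ Q.pathLength T := OnlineProblem.pathLength_nonneg T
  have hℓ : 0 < Real.log (1 / δ) := Real.log_pos (by rw [lt_div_iff₀ hδ]; linarith)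
  set V := (T : ℝ) ^ ((p + 1) / (2 * p)) with hV
  set F := 1 + Q.pathLength T with hF
  set ℓ := Real.log (1 / δ) with hℓd
  have hV0 : 0 < V := by positivity
  have hF0 : 0 < F := by positivity
  -- the bound with a confidence term of size at most `√T`
  have hsmall : ∀ l : ℝ, l ≤ √(T : ℝ) →
      C * (F * (V + (T : ℝ) ^ (1 / (2 * p)) * l)) ≤ 2 * C * (V * F) := fun l hl => by
    have h1 : (T : ℝ) ^ (1 / (2 * p)) * l ≤ V := by rw [hTκ]; gcongr
    calc _ ≤ C * (F * (V + V)) := by gcongr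
      _ = _ := by ring
  rcases le_or_gt ℓ √(T : ℝ) with hcase | hcase
  · refine (one_sub_le_measure hδ.le (h δ hδ hδ1)).trans (measure_mono fun ω hω => ?_)
    refine le_trans hω ((hsmall ℓ hcase).trans ?_)
    have : 0 ≤ C' * (V * F) + (2 * C + C') * (V * ℓ) := by positivity
    linarith
  · have hb := hQ.bounded.ae_boundedAt
    have h2 := one_sub_le_measure (by norm_num) (h (1 / 2) (by norm_num) (by norm_num))
    have hlog2 : Real.log (1 / (1 / 2)) ≤ √(T : ℝ) := by
      rw [one_div_one_div]
      linarith [Real.log_two_lt_d9]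
    obtain ⟨ω', hω'1, hω'2⟩ : ∃ ω', Q.BoundedAt lam eta BX Bg T ω' ∧
        Q.regret lam eta T ω' ≤ 2 * C * (V * F) := by
      have hpos : P {ω | Q.regret lam eta T ω ≤ C * (F * (V
          + (T : ℝ) ^ (1 / (2 * p)) * Real.log (1 / (1 / 2))))} ≠ 0 := by
        intro h0
        rw [h0] at h2
        norm_num at h2
      obtain ⟨ω', h3, h4⟩ := (frequently_ae_iff.2 hpos).and_eventually hb |>.exists
      exact ⟨ω', h4, le_trans h3 (hsmall _ hlog2)⟩
    have hall : ∀ᵐ ω ∂P, Q.regret lam eta T ω ≤ (2 * C + C') * (V * (F + ℓ)) := by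
      filter_upwards [hb] with ω hω
      have h3 := OnlineProblem.regret_sub_regret_le hN hL hQ.costs hω hω'1
      have h4 : (T : ℝ) ≤ V * ℓ := by
        calc (T : ℝ) = √(T : ℝ) * √(T : ℝ) := (Real.mul_self_sqrt (by linarith)).symm
          _ ≤ V * ℓ := by
            gcongr
            rw [hTκ]
            exact le_mul_of_one_le_left (by positivity) hTα
      have h5 : N * (T * (N * ((Bg + L * (2 * BX)) * (2 * BX)))) = C' * T := by rw [hC']; ring
      have h6 : C' * T ≤ C' * (V * ℓ) := by gcongr
      have h7 : 0 ≤ C' * (V * F) + 2 * C * (V * ℓ) := by positivity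
      linarith
    calc ENNReal.ofReal (1 - δ) ≤ 1 := ENNReal.ofReal_le_one.2 (by linarith)
      _ = P Set.univ := measure_univ.symm
      _ ≤ _ := measure_mono_ae (hall.mono fun ω hω _ => hω)

/-- The bounds of the regret are sublinear if the path length is `o(T^((p-1)/(2p)))`. -/
lemma tendsto_bound_div {C l : ℝ} {c : ℕ → ℝ} (hp : 1 < p)
    (hc : Tendsto (fun T : ℕ => c T / (T : ℝ) ^ ((p - 1) / (2 * p))) atTop (𝓝 0)) :
    Tendsto (fun T : ℕ => C * ((T : ℝ) ^ ((1 + p) / (2 * p)) * (1 + c T + l)) / (T : ℝ))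
      atTop (𝓝 0) := by
  have hγ : 0 < (p - 1) / (2 * p) := div_pos (by linarith) (by linarith)
  have h1 : Tendsto (fun T : ℕ => (T : ℝ) ^ (-((p - 1) / (2 * p)))) atTop (𝓝 0) :=
    (tendsto_rpow_neg_atTop hγ).comp tendsto_natCast_atTop_atTop
  have h2 := (hc.add (h1.const_mul (1 + l))).const_mul C
  simp only [mul_zero, add_zero] at h2
  refine h2.congr' ?_
  filter_upwards [eventually_ge_atTop 1] with T hT
  have hT0 : (0 : ℝ) < T := by exact_mod_cast hT
  have e : (T : ℝ) ^ ((1 + p) / (2 * p)) = T * (T : ℝ) ^ (-((p - 1) / (2 * p))) := by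
    nth_rewrite 2 [← Real.rpow_one (T : ℝ)]
    rw [← Real.rpow_add hT0]
    congr 1
    field_simp
    ring
  rw [e, div_eq_mul_inv (c T), ← Real.rpow_neg hT0.le]
  field_simp
  ring

end Main

end ODCSGD

theorem corollary1 (N B : ℕ) (hN : 1 ≤ N) (hB : 1 ≤ B)
    (p σ L BX Bg w a b R : ℝ)
    (hp : 1 < p) (hp2 : p ≤ 2) (hσ : 0 < σ) (hL : 0 ≤ L) (hBX : 0 < BX) (hBg : 0 < Bg)
    (hw : 0 < w) (hw1 : w < 1) (ha : 0 < a) (hab : 0 < a + b)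
    (lam eta : ℕ → ℝ)
    (hlam : lam = ODCSGD.clipLevel Bg (1 / (2 * p)))
    (heta : eta = ODCSGD.stepSize a b ((p + 1) / (2 * p))) :
    -- the high-probability regret bound, with a constant that depends on the parameters above only
    (∃ C : ℝ, 0 < C ∧
      ∀ (d : ℕ) (Ω : Type*) [MeasurableSpace Ω] (P : Measure Ω) [IsProbabilityMeasure P]
        (Q : ODCSGD.OnlineProblem N d Ω) (T : ℕ), 1 ≤ T →
        Q.ConvexSetting P lam eta p σ L BX Bg w B T →
        (∀ i, ‖Q.init i - Q.xstar 1‖ ≤ R) →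
        ∀ δ : ℝ, 0 < δ → δ < 1 →
          ENNReal.ofReal (1 - δ) ≤
            P {ω | Q.regret lam eta T ω ≤
              C * ((T : ℝ) ^ ((1 + p) / (2 * p)) * (1 + Q.pathLength T + Real.log (1 / δ)))})
    ∧
    -- sublinear regret with high probability, if `C_T = o(T^((p-1)/(2p)))`
    (∀ (d : ℕ) (Ω : Type*) [MeasurableSpace Ω] (P : Measure Ω) [IsProbabilityMeasure P]
        (Q : ODCSGD.OnlineProblem N d Ω),
        (∀ T : ℕ, 1 ≤ T → Q.ConvexSetting P lam eta p σ L BX Bg w B T) →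
        Tendsto (fun T : ℕ => Q.pathLength T / (T : ℝ) ^ ((p - 1) / (2 * p))) atTop (𝓝 0) →
        ∀ δ : ℝ, 0 < δ → δ < 1 →
          ∃ bound : ℕ → ℝ, Tendsto (fun T : ℕ => bound T / (T : ℝ)) atTop (𝓝 0) ∧
            ∀ T : ℕ, 1 ≤ T →
              ENNReal.ofReal (1 - δ) ≤ P {ω | Q.regret lam eta T ω ≤ bound T}) := by
  refine ⟨ODCSGD.exists_regret_bound hN hp hp2 hσ hL hBX hBg hw ha hab hlam heta, ?_⟩
  intro d Ω _ P _ Q hQ hpath δ hδ hδ1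
  obtain ⟨C, -, hC⟩ := ODCSGD.exists_regret_bound (B := B)
    (R := ∑ i, ‖Q.init i - Q.xstar 1‖) hN hp hp2 hσ hL hBX hBg hw ha hab hlam heta
  refine ⟨fun T => C * ((T : ℝ) ^ ((1 + p) / (2 * p)) * (1 + Q.pathLength T + Real.log (1 / δ))),
    ODCSGD.tendsto_bound_div hp hpath, fun T hT => ?_⟩
  exact hC d Ω P Q T hT (hQ T hT) (fun i => Finset.single_le_sum
    (f := fun i => ‖Q.init i - Q.xstar 1‖) (fun j _ => norm_nonneg _) (Finset.mem_univ i)) δ hδ hδ1
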